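/- Let ${\cal X}$ be a separable real Banach space, ${\bf X}$ a random element of ${\cal X}$, and $\delta\in{\cal X}$, $\delta\neq{\bf 0}$. Let $m,n\to\infty$ in such a way that, with $N=m+n$, $m/N\to\gamma\in(0,1)$. For each pair $(m,n)$ let ${\bf X}_1,\ldots,{\bf X}_m,{\bf Y}_1,\ldots,{\bf Y}_n$ be independent random elements of ${\cal X}$, where each ${\bf X}_i$ is distributed as ${\bf X}$ and each ${\bf Y}_j$ is distributed as ${\bf X}+\Delta_N$ with $\Delta_N=(mn/N)^{-1/2}\delta$ (shrinking location shifts). Let $\bar{\bf X},\bar{\bf Y}$ be the sample means and let $\Sigma$ denote the covariance of ${\bf X}$. (a) Suppose that ${\cal X}$ is of type 2, i.e. there is $b>0$ such that $E\|\sum_{i=1}^k{\bf U}_i\|^2\le b\sum_{i=1}^kE\|{\bf U}_i\|^2$ for all $k$ and all independent zero mean random elements ${\bf U}_1,\ldots,{\bf U}_k$ of ${\cal X}$ with finite second moments. Let $T_{CFF}=m\|\bar{\bf X}-\bar{\bf Y}\|^2$. If $E(\|{\bf X}\|^2)<\infty$, then there is a (unique) Gaussian law $G(\delta,\Sigma)$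 on ${\cal X}$ with mean $\delta$ and covariance $\Sigma$, and $nN^{-1}T_{CFF}$ converges weakly to $\|{\bf W}\|^2$, where ${\bf W}$ has the law $G(\delta,\Sigma)$. (b) Suppose that ${\cal X}$ is a separable real Hilbert space, and let $\lambda_1\ge\lambda_2\ge\cdots$ be the eigenvalues of the covariance operator $\Sigma$ in decreasing order, counted with multiplicity, with corresponding orthonormal eigenvectors $\psi_1,\psi_2,\ldots$. Suppose that for some $L\ge1$, $\lambda_1>\cdots>\lambda_L>\lambda_{L+1}>0$, and that $E(\|{\bf X}\|^4)<\infty$. Let $\widehat\lambda_1\ge\cdots\ge\widehat\lambda_L$ be the $L$ largest eigenvalues, counted with multiplicity, of the empirical pooled covariance $(N-2)^{-1}\{\sum_{i=1}^m({\bf X}_i-\bar{\bf X})\otimes({\bf X}_i-\bar{\bf X})+\sum_{j=1}^n({\bf Y}_j-\bar{\bf Y})\otimes({\bf Y}_j-\bar{\bf Y})\}$, let $\widehat\psi_1,\ldots,\widehat\psi_L$ be any measurable choice of corresponding orthonormal eigenvectors, and put $$T_{HKR1}=\sum_{k=1}^L\langle\bar{\bf X}-\bar{\bf Y},\widehat\psi_k\rangle^2,\qquad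 T_{HKR2}=\sum_{k=1}^L\widehat\lambda_k^{-1}\langle\bar{\bf X}-\bar{\bf Y},\widehat\psi_k\rangle^2 .$$ Then $mnN^{-1}T_{HKR1}$ converges weakly to $\sum_{k=1}^L\lambda_k\chi^2_{(1)}(\beta_k^2/\lambda_k)$ and $mnN^{-1}T_{HKR2}$ converges weakly to $\sum_{k=1}^L\chi^2_{(1)}(\beta_k^2/\lambda_k)$, where $\beta_k=\langle\delta,\psi_k\rangle$ and the $\chi^2_{(1)}(\beta_k^2/\lambda_k)$ are independent noncentral chi-square variables with 1 degree of freedom and noncentrality parameters $\beta_k^2/\lambda_k$. -/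

import Mathlib

open MeasureTheory ProbabilityTheory Filter Topology
open scoped InnerProductSpace

noncomputable section

namespace TwoSample

universe u

/-- A Banach space `E` is of type 2: there is `b > 0` such that
`E‖U₁ + ⋯ + Uₙ‖² ≤ b (E‖U₁‖² + ⋯ + E‖Uₙ‖²)` for all `n` and all independent zero mean random
elements `U₁, …, Uₙ` of `E` with finite second moments. (The condition only depends on the joint
law of the `Uᵢ`, and `Fin n → E` lives in the universe of `E`.) -/
def IsTypeTwo (E : Type u) [NormedAddCommGroup E] [NormedSpace ℝ E] [MeasurableSpace E] : Prop :=
  ∃ b : ℝ, 0 < b ∧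
    ∀ (Ω : Type u) [MeasurableSpace Ω] (P : Measure Ω) [IsProbabilityMeasure P]
      (n : ℕ) (U : Fin n → Ω → E),
      (∀ i, Measurable (U i)) → iIndepFun U P → (∀ i, MemLp (U i) 2 P) →
      (∀ i, ∫ ω, U i ω ∂P = 0) →
      ∫ ω, ‖∑ i, U i ω‖ ^ 2 ∂P ≤ b * ∑ i, ∫ ω, ‖U i ω‖ ^ 2 ∂P

section Banach

variable {E : Type*} [NormedAddCommGroup E] [NormedSpace ℝ E]

/-- The shrinking shift `(mn/N)^{-1/2} δ`, where `N = m + n`. -/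
def shrinkingShift (δ : E) (m n : ℕ) : E :=
  (√((m : ℝ) * n / (m + n)))⁻¹ • δ

/-- `X₁, …, X_m, Y₁, …, Y_n` are independent random elements of `E`, each `Xᵢ` has the law `μ`,
and each `Yⱼ` has the law of `X + Δ`, where `X` has the law `μ`. -/
structure IsShiftedTwoSample {Ω : Type*} [MeasurableSpace Ω] [MeasurableSpace E]
    (P : Measure Ω) (μ : Measure E) (Δ : E) {m n : ℕ}
    (X : Fin m → Ω → E) (Y : Fin n → Ω → E) : Prop where
  law_X : ∀ i, HasLaw (X i) μ P
  law_Y : ∀ j, HasLaw (Y j) (μ.map (fun x => x + Δ)) P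
  indep : iIndepFun (Sum.elim X Y) P

/-- The sample mean. -/
def sampleMean {n : ℕ} (x : Fin n → E) : E :=
  (n : ℝ)⁻¹ • ∑ i, x i

/-- The statistic `T_CFF = m ‖x̄ - ȳ‖²`. -/
def TCFF {m n : ℕ} (x : Fin m → E) (y : Fin n → E) : ℝ :=
  m * ‖sampleMean x - sampleMean y‖ ^ 2

end Banach

section Hilbert

variable {H : Type*} [NormedAddCommGroup H] [InnerProductSpace ℝ H]

/-- The (centred) covariance operator `Σ` of a law `μ`, given by
`⟪Σ x, y⟫ = Cov(⟪x, X⟫, ⟪y, X⟫)` for `X` with law `μ`. -/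
def covOperator [CompleteSpace H] [MeasurableSpace H] [BorelSpace H] (μ : Measure H) : H →L[ℝ] H :=
  InnerProductSpace.continuousLinearMapOfBilin (covarianceBilin μ)

/-- The sum of the centred squares `∑ᵢ (xᵢ - x̄) ⊗ (xᵢ - x̄)` of a sample. -/
def scatterOperator {n : ℕ} (x : Fin n → H) : H →L[ℝ] H :=
  ∑ i, InnerProductSpace.rankOne ℝ (x i - sampleMean x) (x i - sampleMean x)

/-- The empirical pooled covariance of two samples, with the usual normalization `N - 2`. -/
def pooledCov {m n : ℕ} (x : Fin m → H) (y : Fin n → H) : H →L[ℝ] H :=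
  ((m : ℝ) + n - 2)⁻¹ • (scatterOperator x + scatterOperator y)

/-- `lam 0 ≥ lam 1 ≥ ⋯` are the `K` largest eigenvalues of `A`, counted with multiplicity and in
descending order, and `psi 0, psi 1, …` are corresponding orthonormal eigenvectors: no eigenvector
orthogonal to all the `psi k` belongs to an eigenvalue exceeding one of the `lam k`. -/
structure IsLeadingEigensystem {K : ℕ} (A : H →L[ℝ] H) (lam : Fin K → ℝ) (psi : Fin K → H) :
    Prop where
  orthonormal : Orthonormal ℝ psi
  eigen : ∀ k, A (psi k) = lam k • psi k
  antitone : Antitone lam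
  largest : ∀ (c : ℝ) (x : H), x ≠ 0 → A x = c • x → (∀ k, ⟪psi k, x⟫_ℝ = 0) → ∀ k, c ≤ lam k

/-- The statistic `T_HKR1 = ∑ₖ ⟪x̄ - ȳ, ψ̂ₖ⟫²`. -/
def THKR1 {m n L : ℕ} (psi : Fin L → H) (x : Fin m → H) (y : Fin n → H) : ℝ :=
  ∑ k, ⟪sampleMean x - sampleMean y, psi k⟫_ℝ ^ 2

/-- The statistic `T_HKR2 = ∑ₖ λ̂ₖ⁻¹ ⟪x̄ - ȳ, ψ̂ₖ⟫²`. -/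
def THKR2 {m n L : ℕ} (lam : Fin L → ℝ) (psi : Fin L → H) (x : Fin m → H) (y : Fin n → H) : ℝ :=
  ∑ k, (lam k)⁻¹ * ⟪sampleMean x - sampleMean y, psi k⟫_ℝ ^ 2

end Hilbert

/-- The noncentral chi-square law with one degree of freedom and noncentrality parameter `c ≥ 0`:
the law of `W²` for `W ~ N(√c, 1)`. -/
def noncentralChiSq (c : ℝ) : Measure ℝ :=
  (gaussianReal (√c) 1).map (fun w => w ^ 2)

instance (c : ℝ) : IsProbabilityMeasure (noncentralChiSq c) :=
  Measure.isProbabilityMeasure_map (by fun_prop)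

end TwoSample

end

/-! Both parts rest on a central limit theorem for the scaled mean difference
`D = (mn/N)^{1/2} (ȳ - x̄)`, which is `δ` plus a weighted sum `∑ cₛ Uₛ` of i.i.d. centred elements
with `∑ cₛ² = 1` and `max |cₛ| → 0`. Type 2 bounds second moments of weighted sums by `b ∑ cₛ²`
times those of the summands, so approximating `X` by simple random elements makes the laws of the
sums tight; their characteristic functions converge pointwise to a Gaussian one, hence the laws
converge to a Gaussian law, and `(n/N) T_CFF = ‖D‖²`.

For (b), `(mn/N) ∑ₖ f(λ̂ₖ) ⟪x̄ - ȳ, ψ̂ₖ⟫² = ⟪D, T̂ D⟫` with `T̂ = ∑ₖ f(λ̂ₖ) ψ̂ₖ ⊗ ψ̂ₖ`, and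
`f = 1`, `f(t) = t⁻¹` give the two statistics. The operator `T̂` does not depend on the choice of
signs of the `ψ̂ₖ`, nor on the choice of a basis in an eigenspace, and it is a continuous function
of the pooled covariance at `Σ`: eigenvectors of operators converging to the compact operator `Σ`
with eigenvalues bounded away from zero accumulate at eigenvectors of `Σ`. The law of large numbers
then gives `T̂ → T` in probability, and Slutsky's theorem gives the limit `⟪W, T W⟫`. -/

noncomputable section

open scoped ENNReal NNReal

namespace TwoSample

section TypeTwo

universe u

variable {E : Type u} [NormedAddCommGroup E] [NormedSpace ℝ E] [MeasurableSpace E] [BorelSpace E]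
  [SecondCountableTopology E]

theorem IsTypeTwo.exists_integral_norm_sq_sum_smul_le (hE : IsTypeTwo E) :
    ∃ b : ℝ, 0 < b ∧ ∀ (ι : Type) [Fintype ι] (μ : Measure E) [IsProbabilityMeasure μ]
      (f : E → E), Measurable f → MemLp f 2 μ → ∫ x, f x ∂μ = 0 → ∀ c : ι → ℝ,
      ∫ x, ‖∑ i, c i • f (x i)‖ ^ 2 ∂(Measure.pi fun _ : ι => μ) ≤
        b * ((∑ i, c i ^ 2) * ∫ x, ‖f x‖ ^ 2 ∂μ) := by
  obtain ⟨b, hb, hE⟩ := hE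
  refine ⟨b, hb, fun ι _ μ _ f hf hf2 hf0 c => ?_⟩
  let e := Fintype.equivFin ι
  have hindep : iIndepFun (fun (i : ι) (x : ι → E) => c i • f (x i)) (Measure.pi fun _ : ι => μ) :=
    iIndepFun_pi (X := fun i x => c i • f x) fun i => by fun_prop
  have hsq (i : ι) : ∫ x, ‖c i • f (x i)‖ ^ 2 ∂(Measure.pi fun _ : ι => μ) =
      c i ^ 2 * ∫ x, ‖f x‖ ^ 2 ∂μ := by
    simp only [norm_smul, mul_pow, integral_const_mul, Real.norm_eq_abs, sq_abs]
    rw [integral_comp_eval (μ := fun _ : ι => μ) (f := fun y => ‖f y‖ ^ 2)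
      (hf.norm.pow_const 2).aestronglyMeasurable]
  have hsum := hE (ι → E) (Measure.pi fun _ : ι => μ) (Fintype.card ι)
    (fun i x => c (e.symm i) • f (x (e.symm i))) (fun i => by fun_prop)
    (hindep.precomp e.symm.injective)
    (fun i => (hf2.comp_measurePreserving (measurePreserving_eval _ (e.symm i))).const_smul _)
    (fun i => by rw [integral_smul, integral_comp_eval hf.aestronglyMeasurable, hf0, smul_zero])
  have hreindex (x : ι → E) :
      ∑ i, c (e.symm i) • f (x (e.symm i)) = ∑ i, c i • f (x i) :=
    e.symm.sum_comp fun i => c i • f (x i)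
  simp only [hreindex, hsq] at hsum
  rwa [e.symm.sum_comp fun i => c i ^ 2 * ∫ x, ‖f x‖ ^ 2 ∂μ, ← Finset.sum_mul] at hsum

end TypeTwo

section Tightness

variable {E : Type*} [NormedAddCommGroup E]

theorem isCompact_iInter_cthickening_inv [CompleteSpace E] {K : ℕ → Set E}
    (hK : ∀ k, IsCompact (K k)) : IsCompact (⋂ k : ℕ, Metric.cthickening (1 / (k + 1)) (K k)) := by
  refine TotallyBounded.isCompact_of_isClosed (Metric.totallyBounded_iff.2 fun r hr => ?_)
    (isClosed_iInter fun k => Metric.isClosed_cthickening)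
  obtain ⟨k, hk⟩ := exists_nat_one_div_lt (half_pos hr)
  obtain ⟨t, ht, htK⟩ := Metric.totallyBounded_iff.1 (hK k).totallyBounded (r / 2) (half_pos hr)
  refine ⟨t, ht, fun x hx => ?_⟩
  have hx : x ∈ Metric.thickening (r / 2) (K k) :=
    Metric.cthickening_subset_thickening' (half_pos hr) hk _ (Set.mem_iInter.1 hx k)
  obtain ⟨y, hy, hxy⟩ := Metric.mem_thickening_iff.1 hx
  obtain ⟨z, hz, hyz⟩ := Set.mem_iUnion₂.1 (htK hy)
  refine Set.mem_iUnion₂.2 ⟨z, hz, Metric.mem_ball.2 ?_⟩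
  linarith [dist_triangle x y z, Metric.mem_ball.1 hyz]

theorem isTightMeasureSet_of_forall_cthickening [MeasurableSpace E] [CompleteSpace E]
    {S : Set (Measure E)}
    (h : ∀ ε : ℝ, 0 < ε → ∀ r : ℝ, 0 < r →
      ∃ K : Set E, IsCompact K ∧ ∀ μ ∈ S, μ (Metric.cthickening r K)ᶜ ≤ ENNReal.ofReal ε) :
    IsTightMeasureSet S := by
  rw [isTightMeasureSet_iff_exists_isCompact_measure_compl_le]
  intro ε hε
  obtain ⟨u, hu0, hu⟩ := ENNReal.exists_pos_sum_of_countable hε.ne' ℕ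
  choose K hK hKS using fun k : ℕ => h (u k) (hu0 k) (1 / ((k : ℝ) + 1)) (by positivity)
  refine ⟨_, isCompact_iInter_cthickening_inv hK, fun μ hμ => ?_⟩
  rw [Set.compl_iInter]
  refine (measure_iUnion_le _).trans ((ENNReal.tsum_le_tsum fun k => ?_).trans hu.le)
  simpa only [ENNReal.ofReal_coe_nnreal] using hKS k μ hμ

variable {Ω : Type*} [MeasurableSpace Ω] {P : Measure Ω}

theorem measureReal_norm_ge_le {f : Ω → E} (hf : MemLp f 2 P) {M : ℝ} (hM : 0 < M) :
    P.real {ω | M ≤ ‖f ω‖} ≤ (∫ ω, ‖f ω‖ ^ 2 ∂P) / M ^ 2 := by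
  have hsq : {ω | M ≤ ‖f ω‖} = {ω | M ^ 2 ≤ ‖f ω‖ ^ 2} := by
    ext ω
    exact (pow_le_pow_iff_left₀ hM.le (norm_nonneg _) two_ne_zero).symm
  rw [le_div_iff₀' (by positivity), hsq]
  exact mul_meas_ge_le_integral_of_nonneg (ae_of_all _ fun ω => by positivity)
    (hf.integrable_norm_pow (by simp)) _

theorem integral_norm_sq_le_of_eLpNorm_le {f : Ω → E} (hf : MemLp f 2 P) {η : ℝ} (hη : 0 ≤ η)
    (h : eLpNorm f 2 P ≤ ENNReal.ofReal η) : ∫ ω, ‖f ω‖ ^ 2 ∂P ≤ η ^ 2 := by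
  rw [hf.eLpNorm_eq_integral_rpow_norm (by simp) (by simp), ENNReal.ofReal_le_ofReal_iff hη] at h
  simp only [ENNReal.toReal_ofNat, Real.rpow_ofNat] at h
  rw [← one_div, ← Real.sqrt_eq_rpow] at h
  exact (Real.sqrt_le_left hη).1 h

variable [NormedSpace ℝ E]

theorem isCompact_submodule_inter_closedBall (F : Submodule ℝ E) [FiniteDimensional ℝ F] (M : ℝ) :
    IsCompact ((F : Set E) ∩ Metric.closedBall 0 M) := by
  have := FiniteDimensional.proper_real F
  convert (isCompact_closedBall (0 : F) M).image continuous_subtype_val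
  ext x
  simp [and_comm]

theorem measureReal_notMem_cthickening_le [IsFiniteMeasure P] {F : Submodule ℝ E}
    {U V : Ω → E} (hU : MemLp U 2 P) (hV : MemLp V 2 P) (hUF : ∀ ω, U ω ∈ F)
    {M r : ℝ} (hM : 0 < M) (hr : 0 < r) :
    P.real {ω | U ω + V ω ∉ Metric.cthickening r (F ∩ Metric.closedBall 0 M)} ≤
      (∫ ω, ‖U ω‖ ^ 2 ∂P) / M ^ 2 + (∫ ω, ‖V ω‖ ^ 2 ∂P) / r ^ 2 := by
  refine le_trans (measureReal_mono ?_) ((measureReal_union_le _ _).trans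
    (add_le_add (measureReal_norm_ge_le hU hM) (measureReal_norm_ge_le hV hr)))
  intro ω hω
  by_contra hsmall
  simp only [Set.mem_union, Set.mem_ofPred_eq, not_or, not_le] at hsmall
  refine hω (Metric.mem_cthickening_of_dist_le _ (U ω) _ _ ⟨hUF ω, ?_⟩ ?_)
  · simpa using hsmall.1.le
  · simpa [dist_eq_norm] using hsmall.2.le

theorem eLpNorm_sub_integral_le [IsProbabilityMeasure P] [CompleteSpace E] {p : ℝ≥0∞} (hp : 1 ≤ p)
    {f : Ω → E} (hf : AEStronglyMeasurable f P) :
    eLpNorm (fun ω => f ω - ∫ ω', f ω' ∂P) p P ≤ 2 * eLpNorm f p P := by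
  have hconst : eLpNorm (fun _ : Ω => ∫ ω, f ω ∂P) p P ≤ eLpNorm f p P := by
    calc
      _ = ‖∫ ω, f ω ∂P‖ₑ := by
        simp [eLpNorm_const _ (one_pos.trans_le hp).ne' (IsProbabilityMeasure.ne_zero P)]
      _ ≤ eLpNorm f 1 P := by
        rw [eLpNorm_one_eq_lintegral_enorm]
        exact enorm_integral_le_lintegral_enorm f
      _ ≤ eLpNorm f p P := eLpNorm_le_eLpNorm_of_exponent_le hp hf
  calc
    _ ≤ eLpNorm f p P + eLpNorm (fun _ : Ω => ∫ ω, f ω ∂P) p P :=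
      eLpNorm_sub_le hf aestronglyMeasurable_const hp
    _ ≤ 2 * eLpNorm f p P := by rw [two_mul]; gcongr

variable [MeasurableSpace E] [BorelSpace E] [CompleteSpace E]

theorem exists_finiteDimensional_approx {μ : Measure E} [IsProbabilityMeasure μ]
    (hμ : MemLp id 2 μ) (hμ0 : ∫ x, x ∂μ = 0) {η : ℝ} (hη : 0 < η) :
    ∃ (f : E → E) (F : Submodule ℝ E), FiniteDimensional ℝ F ∧ Measurable f ∧ MemLp f 2 μ ∧
      (∀ x, f x ∈ F) ∧ ∫ x, f x ∂μ = 0 ∧ ∫ x, ‖x - f x‖ ^ 2 ∂μ ≤ η := by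
  obtain ⟨g, hg, hg2⟩ := hμ.exists_simpleFunc_eLpNorm_sub_lt (by simp)
    (ε := ENNReal.ofReal (√η / 2)) (by simpa using hη)
  have hgint : Integrable g μ := hg2.integrable (by simp)
  have hid : Integrable (fun x : E => x) μ := hμ.integrable (by simp)
  have hsub : MemLp (fun x => x - g x) 2 μ := hμ.sub hg2
  set a := ∫ x, g x ∂μ
  have hresid (x : E) : x - (g x - a) = (x - g x) - ∫ y, (y - g y) ∂μ := by
    rw [integral_sub hid hgint, hμ0]
    abel
  refine ⟨fun x => g x - a, Submodule.span ℝ (insert a (Set.range g)),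
    FiniteDimensional.span_of_finite ℝ (g.finite_range.insert a), by fun_prop,
    hg2.sub (memLp_const _), fun x => sub_mem (Submodule.subset_span (by simp))
      (Submodule.subset_span (by simp)), ?_, ?_⟩
  · rw [integral_sub hgint (integrable_const _)]
    simp [a]
  · rw [← Real.sq_sqrt hη.le]
    refine integral_norm_sq_le_of_eLpNorm_le (hμ.sub (hg2.sub (memLp_const _)))
      (Real.sqrt_nonneg η) ?_
    calc
      eLpNorm (fun x => x - (g x - a)) 2 μ
      _ = eLpNorm (fun x => (x - g x) - ∫ y, (y - g y) ∂μ) 2 μ := by simp only [hresid]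
      _ ≤ 2 * eLpNorm (fun x => x - g x) 2 μ :=
        eLpNorm_sub_integral_le (by simp) hsub.aestronglyMeasurable
      _ ≤ 2 * ENNReal.ofReal (√η / 2) := by gcongr; exact hg.le
      _ = ENNReal.ofReal √η := by
        rw [← ENNReal.ofReal_ofNat, ← ENNReal.ofReal_mul (by simp), mul_div_cancel₀ _ two_ne_zero]

end Tightness

section WeightedSum

universe u

variable {E : Type u} [NormedAddCommGroup E] [NormedSpace ℝ E] [MeasurableSpace E] [BorelSpace E]
  [SecondCountableTopology E]

/-- The law of `∑ i, c i • Xᵢ` for independent `Xᵢ` with law `μ`. -/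
def weightedSumLaw {ι : Type} [Fintype ι] (μ : Measure E) (c : ι → ℝ) : Measure E :=
  (Measure.pi fun _ : ι => μ).map (fun x => ∑ i, c i • x i)

instance {ι : Type} [Fintype ι] (μ : Measure E) [IsProbabilityMeasure μ] (c : ι → ℝ) :
    IsProbabilityMeasure (weightedSumLaw μ c) :=
  Measure.isProbabilityMeasure_map (Measurable.aemeasurable (by fun_prop))

variable [CompleteSpace E]

theorem exists_isCompact_weightedSumLaw_compl_cthickening_le (hE : IsTypeTwo E) {μ : Measure E}
    [IsProbabilityMeasure μ] (hμ : MemLp id 2 μ) (hμ0 : ∫ x, x ∂μ = 0)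
    {ε r : ℝ} (hε : 0 < ε) (hr : 0 < r) :
    ∃ K : Set E, IsCompact K ∧ ∀ (ι : Type) [Fintype ι] (c : ι → ℝ), ∑ i, c i ^ 2 ≤ 1 →
      (weightedSumLaw μ c).real (Metric.cthickening r K)ᶜ ≤ ε := by
  obtain ⟨b, hb, hbE⟩ := hE.exists_integral_norm_sq_sum_smul_le
  obtain ⟨f, F, hF, hfm, hf2, hfF, hf0, hfη⟩ := exists_finiteDimensional_approx hμ hμ0
    (η := ε / 2 * r ^ 2 / b) (by positivity)
  obtain ⟨M, hM0, hM⟩ : ∃ M : ℝ, 0 < M ∧ (b * ∫ x, ‖f x‖ ^ 2 ∂μ) / M ^ 2 ≤ ε / 2 :=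
    ((eventually_gt_atTop 0).and ((tendsto_const_nhds.div_atTop
      (tendsto_pow_atTop two_ne_zero)).eventually_le_const (half_pos hε))).exists
  refine ⟨F ∩ Metric.closedBall 0 M, isCompact_submodule_inter_closedBall F _, fun ι _ c hc => ?_⟩
  let Q : Measure (ι → E) := Measure.pi fun _ : ι => μ
  have hL2 {g : E → E} (hg : MemLp g 2 μ) : MemLp (fun x : ι → E => ∑ i, c i • g (x i)) 2 Q :=
    memLp_finsetSum _ fun i _ =>
      (hg.comp_measurePreserving (measurePreserving_eval _ i)).const_smul (c i)
  have hbound {g : E → E} (hgm : Measurable g) (hg : MemLp g 2 μ) (hg0 : ∫ x, g x ∂μ = 0) :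
      ∫ x, ‖∑ i, c i • g (x i)‖ ^ 2 ∂Q ≤ b * ∫ x, ‖g x‖ ^ 2 ∂μ := by
    refine (hbE ι μ g hgm hg hg0 c).trans ?_
    gcongr
    exact mul_le_of_le_one_left (by positivity) hc
  have hresid2 : MemLp (fun x => x - f x) 2 μ := hμ.sub hf2
  have hresid0 : ∫ x, (x - f x) ∂μ = 0 := by
    have hid : Integrable (fun x : E => x) μ := hμ.integrable (by simp)
    rw [integral_sub hid (hf2.integrable (by simp)), hμ0, hf0, sub_zero]
  have hresid : ∫ x, ‖∑ i, c i • (x i - f (x i))‖ ^ 2 ∂Q ≤ ε / 2 * r ^ 2 := by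
    refine (hbound (by fun_prop) hresid2 hresid0).trans ?_
    rwa [← le_div_iff₀' hb]
  rw [weightedSumLaw, map_measureReal_apply (by fun_prop)
    Metric.isClosed_cthickening.measurableSet.compl]
  have hsplit (x : ι → E) :
      ∑ i, c i • f (x i) + ∑ i, c i • (x i - f (x i)) = ∑ i, c i • x i := by
    simp only [← Finset.sum_add_distrib, ← smul_add, add_sub_cancel]
  have hcompl := (measureReal_notMem_cthickening_le (hL2 hf2) (hL2 hresid2)
    (fun x => F.sum_mem fun i _ => F.smul_mem _ (hfF _)) hM0 hr)
  simp only [hsplit] at hcompl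
  refine hcompl.trans ((add_le_add ?_ ?_).trans (add_halves ε).le)
  · exact (div_le_div_of_nonneg_right (hbound hfm hf2 hf0) (sq_nonneg M)).trans hM
  · exact (div_le_iff₀ (by positivity)).2 hresid

theorem isTightMeasureSet_weightedSumLaw (hE : IsTypeTwo E) {μ : Measure E}
    [IsProbabilityMeasure μ] (hμ : MemLp id 2 μ) (hμ0 : ∫ x, x ∂μ = 0) :
    IsTightMeasureSet {ν : Measure E | ∃ (ι : Type) (_ : Fintype ι) (c : ι → ℝ),
      ∑ i, c i ^ 2 ≤ 1 ∧ ν = weightedSumLaw μ c} := by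
  refine isTightMeasureSet_of_forall_cthickening fun ε hε r hr => ?_
  obtain ⟨K, hK, hKμ⟩ := exists_isCompact_weightedSumLaw_compl_cthickening_le hE hμ hμ0 hε hr
  refine ⟨K, hK, ?_⟩
  rintro ν ⟨ι, _, c, hc, rfl⟩
  exact (ENNReal.le_ofReal_iff_toReal_le (measure_ne_top _ _) hε.le).2 (hKμ ι c hc)

end WeightedSum

section CharFun

theorem norm_prod_sub_prod_le {ι R : Type*} [NormedCommRing R] [NormOneClass R] (s : Finset ι)
    {a b : ι → R} (ha : ∀ i ∈ s, ‖a i‖ ≤ 1) (hb : ∀ i ∈ s, ‖b i‖ ≤ 1) :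
    ‖∏ i ∈ s, a i - ∏ i ∈ s, b i‖ ≤ ∑ i ∈ s, ‖a i - b i‖ := by
  classical
  induction s using Finset.induction_on with
  | empty => simp
  | insert i s hi ih =>
    rw [Finset.forall_mem_insert] at ha hb
    rw [Finset.prod_insert hi, Finset.prod_insert hi, Finset.sum_insert hi]
    have hprod : ‖∏ j ∈ s, a j‖ ≤ 1 :=
      (s.norm_prod_le a).trans (Finset.prod_le_one (fun _ _ => norm_nonneg _) ha.2)
    calc
      _ = ‖(a i - b i) * ∏ j ∈ s, a j + b i * (∏ j ∈ s, a j - ∏ j ∈ s, b j)‖ := by ring_nf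
      _ ≤ ‖a i - b i‖ * ‖∏ j ∈ s, a j‖ + ‖b i‖ * ‖∏ j ∈ s, a j - ∏ j ∈ s, b j‖ :=
        (norm_add_le _ _).trans (add_le_add (norm_mul_le _ _) (norm_mul_le _ _))
      _ ≤ _ := add_le_add (mul_le_of_le_one_right (norm_nonneg _) hprod)
        ((mul_le_of_le_one_left (norm_nonneg _) hb.1).trans (ih ha.2 hb.2))

theorem charFun_sub_charFun_isLittleO_pow {ν ν' : Measure ℝ} [IsFiniteMeasure ν]
    [IsFiniteMeasure ν'] {n : ℕ} (hν : MemLp id n ν) (hν' : MemLp id n ν')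
    (hmoment : ∀ k ≤ n, ∫ x, x ^ k ∂ν = ∫ x, x ^ k ∂ν') :
    (fun t => charFun ν t - charFun ν' t) =o[𝓝 0] fun t => t ^ n := by
  have htaylor : taylorWithinEval (charFun ν) n Set.univ 0 =
      taylorWithinEval (charFun ν') n Set.univ 0 := by
    ext t
    rw [taylorWithinEval_charFun_zero hν, taylorWithinEval_charFun_zero hν']
    refine Finset.sum_congr rfl fun k hk => ?_
    rw [hmoment k (Finset.mem_range_succ_iff.1 hk)]
  simpa [htaylor] using (taylor_isLittleO_univ (x₀ := 0) (contDiff_charFun hν)).sub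
    (taylor_isLittleO_univ (x₀ := 0) (contDiff_charFun hν'))

theorem tendsto_prod_charFun_sub_prod_charFun {ν ν' : Measure ℝ} [IsProbabilityMeasure ν]
    [IsProbabilityMeasure ν'] (hν : MemLp id 2 ν) (hν' : MemLp id 2 ν')
    (hmean : ∫ x, x ∂ν = ∫ x, x ∂ν') (hsq : ∫ x, x ^ 2 ∂ν = ∫ x, x ^ 2 ∂ν')
    {α : Type*} {l : Filter α} {ι : α → Type*} [∀ j, Fintype (ι j)] {c : ∀ j, ι j → ℝ}
    (hc : ∀ᶠ j in l, ∑ i, c j i ^ 2 ≤ 1) (hmax : ∀ ε > 0, ∀ᶠ j in l, ∀ i, |c j i| ≤ ε) :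
    Tendsto (fun j => ∏ i, charFun ν (c j i) - ∏ i, charFun ν' (c j i)) l (𝓝 0) := by
  have hlittleO := charFun_sub_charFun_isLittleO_pow (n := 2) hν hν' fun k hk => by
    interval_cases k <;> simp [hmean, hsq]
  refine Metric.tendsto_nhds.2 fun ε hε => ?_
  obtain ⟨r, hr, hball⟩ := Metric.eventually_nhds_iff.1 (hlittleO.bound (half_pos hε))
  filter_upwards [hc, hmax (r / 2) (half_pos hr)] with j hj hjmax
  have hsmall (i : ι j) : ‖charFun ν (c j i) - charFun ν' (c j i)‖ ≤ ε / 2 * c j i ^ 2 := by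
    simpa using hball (y := c j i) (by simpa using (hjmax i).trans_lt (half_lt_self hr))
  rw [dist_zero_right]
  calc
    _ ≤ ∑ i, ‖charFun ν (c j i) - charFun ν' (c j i)‖ :=
      norm_prod_sub_prod_le _ (fun _ _ => norm_charFun_le_one _) fun _ _ => norm_charFun_le_one _
    _ ≤ ∑ i, ε / 2 * c j i ^ 2 := Finset.sum_le_sum fun i _ => hsmall i
    _ ≤ ε / 2 := by
      rw [← Finset.mul_sum]
      exact mul_le_of_le_one_right (half_pos hε).le hj
    _ < ε := half_lt_self hε

variable {E : Type*} [NormedAddCommGroup E] [NormedSpace ℝ E] [MeasurableSpace E] [BorelSpace E]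

theorem integral_sq_map_dual_eq_covarianceBilinDual [CompleteSpace E] {μ : Measure E}
    [IsProbabilityMeasure μ] (hμ : MemLp id 2 μ) (hμ0 : ∫ x, x ∂μ = 0) (ℓ : StrongDual ℝ E) :
    ∫ x, x ^ 2 ∂(μ.map ℓ) = covarianceBilinDual μ ℓ ℓ := by
  have hℓ0 : μ[ℓ] = 0 := by
    rw [ℓ.integral_comp_comm (φ := fun x => x) (hμ.integrable (by simp)), hμ0, map_zero]
  rw [covarianceBilinDual_self_eq_variance hμ, variance_of_integral_eq_zero (by fun_prop) hℓ0,
    integral_map (by fun_prop) (by fun_prop)]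

variable [SecondCountableTopology E]

theorem charFunDual_weightedSumLaw {ι : Type} [Fintype ι] (μ : Measure E)
    [IsProbabilityMeasure μ] (c : ι → ℝ) (ℓ : StrongDual ℝ E) :
    charFunDual (weightedSumLaw μ c) ℓ = ∏ i, charFun (μ.map ℓ) (c i) := by
  simp only [charFun_map_eq_charFunDual_smul, charFunDual_apply]
  rw [weightedSumLaw, integral_map (Measurable.aemeasurable (by fun_prop)) (by fun_prop),
    ← integral_fintype_prod_eq_prod (μ := fun _ : ι => μ)
      (fun i x => Complex.exp (((c i • ℓ) x : ℝ) * Complex.I))]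
  simp [← Complex.exp_sum, Finset.sum_mul]

variable [CompleteSpace E]

theorem tendsto_charFunDual_weightedSumLaw {μ : Measure E} [IsProbabilityMeasure μ]
    (hμ : MemLp id 2 μ) (hμ0 : ∫ x, x ∂μ = 0) {α : Type*} {l : Filter α} {ι : α → Type}
    [∀ j, Fintype (ι j)] {c : ∀ j, ι j → ℝ} (hc : ∀ᶠ j in l, ∑ i, c j i ^ 2 = 1)
    (hmax : ∀ ε > 0, ∀ᶠ j in l, ∀ i, |c j i| ≤ ε) (ℓ : StrongDual ℝ E) :
    Tendsto (fun j => charFunDual (weightedSumLaw μ (c j)) ℓ) l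
      (𝓝 (Complex.exp (-covarianceBilinDual μ ℓ ℓ / 2))) := by
  obtain ⟨v, hv⟩ : ∃ v : ℝ≥0, v = covarianceBilinDual μ ℓ ℓ :=
    ⟨⟨_, covarianceBilinDual_self_nonneg ℓ⟩, rfl⟩
  have : IsProbabilityMeasure (μ.map ℓ) := Measure.isProbabilityMeasure_map (by fun_prop)
  have hmean : ∫ x, x ∂(μ.map ℓ) = 0 := by
    rw [integral_map (by fun_prop) (by fun_prop),
      ℓ.integral_comp_comm (φ := fun x => x) (hμ.integrable (by simp)), hμ0, map_zero]
  have hsq : ∫ x, x ^ 2 ∂(gaussianReal 0 v) = v := by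
    rw [← variance_id_gaussianReal (μ := 0) (v := v),
      variance_of_integral_eq_zero (by fun_prop) (by simp)]
    rfl
  have hdiff := tendsto_prod_charFun_sub_prod_charFun (ν := μ.map ℓ) (ν' := gaussianReal 0 v)
    ((memLp_map_measure_iff (by fun_prop) (by fun_prop)).2 (ℓ.comp_memLp' hμ))
    (memLp_id_gaussianReal 2) (by rw [hmean, integral_id_gaussianReal])
    (by rw [hsq, hv, integral_sq_map_dual_eq_covarianceBilinDual hμ hμ0])
    (hc.mono fun j hj => hj.le) hmax
  have hgaussian : ∀ᶠ j in l, ∏ i, charFun (gaussianReal 0 v) (c j i) = Complex.exp (-v / 2) := by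
    filter_upwards [hc] with j hj
    simp only [charFun_gaussianReal, ← Complex.exp_sum]
    congr 1
    simp only [Complex.ofReal_zero, mul_zero, zero_mul, zero_sub, Finset.sum_neg_distrib,
      ← Finset.sum_div, ← Finset.mul_sum, ← Complex.ofReal_pow, ← Complex.ofReal_sum, hj,
      Complex.ofReal_one, mul_one, neg_div]
  simp only [charFunDual_weightedSumLaw, ← hv]
  rw [← zero_add (Complex.exp _)]
  refine (hdiff.add (tendsto_const_nhds.congr' (hgaussian.mono fun _ hj => hj.symm))).congr
    fun j => ?_
  simp

theorem exists_tendsto_of_isTight_of_tendsto_charFunDual {α : Type*} {l : Filter α} [l.NeBot]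
    {μ : α → ProbabilityMeasure E} (ht : IsTightMeasureSet {(μ j : Measure E) | j})
    {Φ : StrongDual ℝ E → ℂ}
    (h : ∀ ℓ, Tendsto (fun j => charFunDual (μ j : Measure E) ℓ) l (𝓝 (Φ ℓ))) :
    ∃ G : ProbabilityMeasure E, Tendsto μ l (𝓝 G) ∧
      ∀ ℓ, charFunDual (G : Measure E) ℓ = Φ ℓ := by
  have hcompact : IsCompact (closure {μ j | j}) :=
    isCompact_closure_of_isTightMeasureSet (by simpa using ht)
  have hcluster (U : Ultrafilter α) (hU : (U : Filter α) ≤ l) :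
      ∃ G : ProbabilityMeasure E, Tendsto μ U (𝓝 G) ∧
        ∀ ℓ, charFunDual (G : Measure E) ℓ = Φ ℓ := by
    obtain ⟨G, -, hG : Tendsto _ _ _⟩ := hcompact.ultrafilter_le_nhds (U.map μ)
      (.trans (by simp) (monotone_principal subset_closure))
    refine ⟨G, hG, fun ℓ => tendsto_nhds_unique ?_ ((h ℓ).mono_left hU)⟩
    exact (ProbabilityMeasure.tendsto_iff_forall_integral_rclike_tendsto ℂ).1 hG
      (BoundedContinuousFunction.probCharDual ℓ)
  obtain ⟨G, -, hG⟩ := hcluster (Ultrafilter.of l) (Ultrafilter.of_le _)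
  refine ⟨G, (tendsto_iff_ultrafilter _ _ _).2 fun U hU => ?_, hG⟩
  obtain ⟨G', hUG', hG'⟩ := hcluster U hU
  have hlaw : (G' : Measure E) = G :=
    Measure.ext_of_charFunDual (funext fun ℓ => (hG' ℓ).trans (hG ℓ).symm)
  obtain rfl : G' = G := Subtype.ext hlaw
  exact hUG'

end CharFun

section CentralLimit

universe u

variable {E : Type u} [NormedAddCommGroup E] [NormedSpace ℝ E] [MeasurableSpace E] [BorelSpace E]
  [SecondCountableTopology E] [CompleteSpace E]

theorem exists_tendsto_weightedSumLaw (hE : IsTypeTwo E) {μ : Measure E}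
    [IsProbabilityMeasure μ] (hμ : MemLp id 2 μ) (hμ0 : ∫ x, x ∂μ = 0) {α : Type*} {l : Filter α}
    [l.NeBot] {ι : α → Type} [∀ j, Fintype (ι j)] {c : ∀ j, ι j → ℝ}
    (hc1 : ∀ j, ∑ i, c j i ^ 2 ≤ 1) (hc : ∀ᶠ j in l, ∑ i, c j i ^ 2 = 1)
    (hmax : ∀ ε > 0, ∀ᶠ j in l, ∀ i, |c j i| ≤ ε) :
    ∃ G : ProbabilityMeasure E,
      Tendsto (β := ProbabilityMeasure E) (fun j => ⟨weightedSumLaw μ (c j), inferInstance⟩) l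
        (𝓝 G) ∧
      ∀ ℓ, charFunDual (G : Measure E) ℓ = Complex.exp (-covarianceBilinDual μ ℓ ℓ / 2) := by
  refine exists_tendsto_of_isTight_of_tendsto_charFunDual
    ((isTightMeasureSet_weightedSumLaw hE hμ hμ0).subset ?_)
    (tendsto_charFunDual_weightedSumLaw hμ hμ0 hc hmax)
  rintro _ ⟨j, rfl⟩
  exact ⟨ι j, inferInstance, c j, hc1 j, rfl⟩

theorem exists_isGaussian_tendsto_map_const_add_weightedSumLaw (hE : IsTypeTwo E) {μ : Measure E}
    [IsProbabilityMeasure μ] (hμ : MemLp id 2 μ) (hμ0 : ∫ x, x ∂μ = 0) (δ : E) {α : Type*}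
    {l : Filter α} [l.NeBot] {ι : α → Type} [∀ j, Fintype (ι j)] {c : ∀ j, ι j → ℝ}
    (hc1 : ∀ j, ∑ i, c j i ^ 2 ≤ 1) (hc : ∀ᶠ j in l, ∑ i, c j i ^ 2 = 1)
    (hmax : ∀ ε > 0, ∀ᶠ j in l, ∀ i, |c j i| ≤ ε) :
    ∃ G : ProbabilityMeasure E, IsGaussian (G : Measure E) ∧ ∫ x, x ∂(G : Measure E) = δ ∧
      covarianceBilinDual (G : Measure E) = covarianceBilinDual μ ∧
      Tendsto (β := ProbabilityMeasure E)
        (fun j => ⟨(weightedSumLaw μ (c j)).map (δ + ·),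
          Measure.isProbabilityMeasure_map (by fun_prop)⟩) l (𝓝 G) := by
  have hshift : Continuous (δ + · : E → E) := by fun_prop
  obtain ⟨G₀, hG₀, hG₀dual⟩ := exists_tendsto_weightedSumLaw hE hμ hμ0 hc1 hc hmax
  let G : ProbabilityMeasure E := G₀.map hshift.measurable.aemeasurable
  have hGdual (ℓ : StrongDual ℝ E) : charFunDual (G : Measure E) ℓ =
      Complex.exp (ℓ δ * Complex.I - covarianceBilinDual μ ℓ ℓ / 2) := by
    change charFunDual ((G₀ : Measure E).map (δ + ·)) ℓ = _
    rw [charFunDual_map_const_add, hG₀dual, ← Complex.exp_add]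
    ring_nf
  obtain ⟨hmean, hcov⟩ := gaussian_charFunDual_congr isPosSemidef_covarianceBilinDual hGdual
  exact ⟨G, isGaussian_iff_gaussian_charFunDual.2
    ⟨δ, covarianceBilinDual μ, isPosSemidef_covarianceBilinDual, hGdual⟩, hmean.symm, hcov.symm,
    ProbabilityMeasure.tendsto_map_of_tendsto_of_continuous _ _ hG₀ hshift⟩

end CentralLimit

section Sample

variable {E : Type*} [NormedAddCommGroup E]

/-- The pooled sample, with the constant `a` subtracted from the first sample and `Δ + a` from the
second one. For `a` the mean of `μ` and `Δ` the shift this gives independent centred variables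
with the same law. -/
def centeredSample (a Δ : E) {m n : ℕ} (x : Fin m → E) (y : Fin n → E) : Fin m ⊕ Fin n → E :=
  Sum.elim (fun i => x i - a) (fun i => y i - Δ - a)

/-- The coefficients of the standardized difference of the sample means, as a weighted sum over the
pooled sample. -/
def meanDiffWeight (m n : ℕ) : Fin m ⊕ Fin n → ℝ :=
  Sum.elim (fun _ => -(√((m : ℝ) * n / (m + n)) / m)) (fun _ => √((m : ℝ) * n / (m + n)) / n)

/-- The standardized difference `√(mn/N) (ȳ - x̄)` of the sample means, with the sign for which its
limit has mean `δ`. -/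
def meanDiff [NormedSpace ℝ E] {m n : ℕ} (x : Fin m → E) (y : Fin n → E) : E :=
  √((m : ℝ) * n / (m + n)) • (sampleMean y - sampleMean x)

theorem sum_sq_meanDiffWeight (m n : ℕ) :
    ∑ s, meanDiffWeight m n s ^ 2 = if m = 0 ∨ n = 0 then 0 else 1 := by
  simp only [meanDiffWeight, Fintype.sum_sum_type, Sum.elim_inl, Sum.elim_inr, Finset.sum_const,
    Finset.card_univ, Fintype.card_fin, nsmul_eq_mul, neg_sq, div_pow]
  rw [Real.sq_sqrt (by positivity)]
  split_ifs with h
  · rcases h with rfl | rfl <;> simp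
  · obtain ⟨hm, hn⟩ := not_or.1 h
    have hN : (m : ℝ) + n ≠ 0 := by positivity
    field_simp
    ring

theorem sq_meanDiffWeight_le (m n : ℕ) (s : Fin m ⊕ Fin n) :
    meanDiffWeight m n s ^ 2 ≤ (m : ℝ)⁻¹ + (n : ℝ)⁻¹ := by
  have hpos (i : Fin m ⊕ Fin n) : 0 < (m : ℝ) + n := by
    exact_mod_cast i.elim (fun i => Nat.add_pos_left i.pos n) (fun i => Nat.add_pos_right m i.pos)
  have hN := hpos s
  have hfrac {k : ℕ} (hk : (k : ℝ) ≤ m + n) : (k : ℝ) / (m + n) ≤ 1 :=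
    div_le_one_of_le₀ hk hN.le
  rcases s with i | i <;>
    simp only [meanDiffWeight, Sum.elim_inl, Sum.elim_inr, neg_sq, div_pow] <;>
    rw [Real.sq_sqrt (by positivity)]
  · have hm : (m : ℝ) ≠ 0 := by exact_mod_cast i.pos.ne'
    calc
      (m : ℝ) * n / (m + n) / m ^ 2 = (m : ℝ)⁻¹ * (n / (m + n)) := by field_simp
      _ ≤ (m : ℝ)⁻¹ := mul_le_of_le_one_right (by positivity) (hfrac (by simp))
      _ ≤ (m : ℝ)⁻¹ + (n : ℝ)⁻¹ := le_add_of_nonneg_right (by positivity)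
  · have hn : (n : ℝ) ≠ 0 := by exact_mod_cast i.pos.ne'
    calc
      (m : ℝ) * n / (m + n) / n ^ 2 = (n : ℝ)⁻¹ * (m / (m + n)) := by field_simp
      _ ≤ (n : ℝ)⁻¹ := mul_le_of_le_one_right (by positivity) (hfrac (by simp))
      _ ≤ (m : ℝ)⁻¹ + (n : ℝ)⁻¹ := le_add_of_nonneg_left (by positivity)

theorem meanDiff_eq_add_sum [NormedSpace ℝ E] (a δ : E) {m n : ℕ} (hm : 0 < m) (hn : 0 < n)
    (x : Fin m → E) (y : Fin n → E) :
    meanDiff x y =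
      δ + ∑ s, meanDiffWeight m n s • centeredSample a (shrinkingShift δ m n) x y s := by
  have hr : √((m : ℝ) * n / (m + n)) ≠ 0 := by positivity
  simp only [meanDiff, meanDiffWeight, centeredSample, sampleMean, Fintype.sum_sum_type,
    Sum.elim_inl, Sum.elim_inr, ← Finset.smul_sum, Finset.sum_sub_distrib, Finset.sum_const,
    Finset.card_univ, Fintype.card_fin, shrinkingShift, ← Nat.cast_smul_eq_nsmul ℝ]
  generalize √((m : ℝ) * n / (m + n)) = r at hr
  match_scalars <;> field_simp <;> ring

variable [MeasurableSpace E] [BorelSpace E] {Ω : Type*} [MeasurableSpace Ω] {P : Measure Ω}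
  {μ : Measure E} {Δ : E} {m n : ℕ} {X : Fin m → Ω → E} {Y : Fin n → Ω → E}

theorem IsShiftedTwoSample.hasLaw_centeredSample (h : IsShiftedTwoSample P μ Δ X Y) (a : E) :
    HasLaw (fun ω => centeredSample a Δ (fun i => X i ω) (fun i => Y i ω))
      (Measure.pi fun _ => μ.map (fun x => x - a)) P := by
  let center (s : Fin m ⊕ Fin n) : E → E := Sum.elim (fun _ x => x - a) (fun _ x => x - Δ - a) s
  have hcenter (s) : Measurable (center s) := by
    rcases s with s | s <;> simp only [center, Sum.elim_inl, Sum.elim_inr] <;> fun_prop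
  have hlaw (s) : HasLaw (fun ω => center s (Sum.elim X Y s ω)) (μ.map (fun x => x - a)) P := by
    rcases s with i | i
    · exact HasLaw.fun_comp ⟨(hcenter (.inl i)).aemeasurable, rfl⟩ (h.law_X i)
    · refine HasLaw.fun_comp ⟨(hcenter (.inr i)).aemeasurable, ?_⟩ (h.law_Y i)
      rw [Measure.map_map (hcenter _) (by fun_prop)]
      congr with x
      simp [center]
  refine (iIndepFun.hasLaw_pi hlaw (h.indep.comp center hcenter)).congr (ae_of_all _ fun ω => ?_)
  ext (s | s) <;> rfl

theorem IsShiftedTwoSample.hasLaw_meanDiff [NormedSpace ℝ E] [SecondCountableTopology E] {δ : E}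
    (h : IsShiftedTwoSample P μ (shrinkingShift δ m n) X Y) (hm : 0 < m) (hn : 0 < n) (a : E) :
    HasLaw (fun ω => meanDiff (fun i => X i ω) (fun i => Y i ω))
      ((weightedSumLaw (μ.map (fun x => x - a)) (meanDiffWeight m n)).map (δ + ·)) P := by
  have hsum : Measurable fun z : Fin m ⊕ Fin n → E => ∑ s, meanDiffWeight m n s • z s := by
    fun_prop
  have hlaw : HasLaw (fun z : Fin m ⊕ Fin n → E => δ + ∑ s, meanDiffWeight m n s • z s)
      ((weightedSumLaw (μ.map (fun x => x - a)) (meanDiffWeight m n)).map (δ + ·))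
      (Measure.pi fun _ => μ.map (fun x => x - a)) :=
    ⟨(hsum.const_add δ).aemeasurable, by
      rw [weightedSumLaw, Measure.map_map (by fun_prop) hsum]; rfl⟩
  simpa only [meanDiff_eq_add_sum a δ hm hn] using hlaw.fun_comp (h.hasLaw_centeredSample a)

end Sample

section MeanDifference

universe u

theorem eventually_abs_meanDiffWeight_le {α : Type*} {l : Filter α} {m n : α → ℕ}
    (hm : Tendsto m l atTop) (hn : Tendsto n l atTop) {ε : ℝ} (hε : 0 < ε) :
    ∀ᶠ j in l, ∀ s, |meanDiffWeight (m j) (n j) s| ≤ ε := by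
  have hlim : Tendsto (fun j => (m j : ℝ)⁻¹ + (n j : ℝ)⁻¹) l (𝓝 0) := by
    simpa using ((tendsto_inv_atTop_nhds_zero_nat (𝕜 := ℝ)).comp hm).add
      ((tendsto_inv_atTop_nhds_zero_nat (𝕜 := ℝ)).comp hn)
  filter_upwards [hlim.eventually_le_const (pow_pos hε 2)] with j hj s
  exact abs_le_of_sq_le_sq ((sq_meanDiffWeight_le _ _ s).trans hj) hε.le

variable {E : Type u} [NormedAddCommGroup E] [MeasurableSpace E] [BorelSpace E]

theorem memLp_id_map_sub_const {μ : Measure E} [IsFiniteMeasure μ] {p : ℝ≥0∞}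
    (hμ : MemLp id p μ) (a : E) : MemLp id p (μ.map (fun x => x - a)) :=
  (measurableEmbedding_subRight a).memLp_map_measure_iff.2 (hμ.sub (memLp_const a))

variable [NormedSpace ℝ E] [CompleteSpace E]

theorem integral_map_sub_integral {μ : Measure E} [IsProbabilityMeasure μ]
    (hμ : Integrable id μ) : ∫ x, x ∂(μ.map (fun x => x - ∫ y, y ∂μ)) = 0 := by
  have hint : Integrable (fun x : E => x) μ := hμ
  rw [(measurableEmbedding_subRight _).integral_map, integral_sub hint (integrable_const _)]
  simp

theorem covarianceBilinDual_map_sub_integral {μ : Measure E} [IsProbabilityMeasure μ]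
    (hμ : Integrable id μ) :
    covarianceBilinDual (μ.map (fun x => x - ∫ y, y ∂μ)) = covarianceBilinDual μ := by
  rw [covarianceBilinDual, integral_map_sub_integral hμ]
  simp [covarianceBilinDual]

variable [SecondCountableTopology E] {α : Type*} {l : Filter α} [l.NeBot] {m n : α → ℕ}
  {Ω : α → Type*} [∀ j, MeasurableSpace (Ω j)] {P : ∀ j, Measure (Ω j)}
  [∀ j, IsProbabilityMeasure (P j)] {μ : Measure E} [IsProbabilityMeasure μ] {δ : E}
  {X : ∀ j, Fin (m j) → Ω j → E} {Y : ∀ j, Fin (n j) → Ω j → E}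

theorem exists_isGaussian_tendstoInDistribution_meanDiff (hE : IsTypeTwo E)
    (hm : Tendsto m l atTop) (hn : Tendsto n l atTop)
    (h : ∀ j, IsShiftedTwoSample (P j) μ (shrinkingShift δ (m j) (n j)) (X j) (Y j))
    (hμ : MemLp id 2 μ) :
    ∃ (G : Measure E) (_ : IsGaussian G),
      ∫ x, x ∂G = δ ∧ covarianceBilinDual G = covarianceBilinDual μ ∧
      TendstoInDistribution (fun j ω => meanDiff (fun i => X j i ω) (fun i => Y j i ω))
        l (id : E → E) P G := by
  have hint : Integrable id μ := hμ.integrable (by simp)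
  have : IsProbabilityMeasure (μ.map (fun x => x - ∫ y, y ∂μ)) :=
    Measure.isProbabilityMeasure_map (by fun_prop)
  have hpos : ∀ᶠ j in l, 0 < m j ∧ 0 < n j :=
    (hm.eventually_gt_atTop 0).and (hn.eventually_gt_atTop 0)
  obtain ⟨G, hG, hmean, hcov, hlim⟩ := exists_isGaussian_tendsto_map_const_add_weightedSumLaw hE
    (memLp_id_map_sub_const hμ _) (integral_map_sub_integral hint) δ
    (c := fun j => meanDiffWeight (m j) (n j))
    (fun j => by rw [sum_sq_meanDiffWeight]; split_ifs <;> simp)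
    (hpos.mono fun j hj => by rw [sum_sq_meanDiffWeight, if_neg (by omega)])
    fun ε hε => eventually_abs_meanDiffWeight_le hm hn hε
  rw [covarianceBilinDual_map_sub_integral hint] at hcov
  refine ⟨G, hG, hmean, hcov, ⟨fun j => ?_, aemeasurable_id, ?_⟩⟩
  · have hX (i) : AEMeasurable (X j i) (P j) := ((h j).law_X i).aemeasurable
    have hY (i) : AEMeasurable (Y j i) (P j) := ((h j).law_Y i).aemeasurable
    simp only [meanDiff, sampleMean]
    fun_prop
  · have hid : (⟨(G : Measure E).map id, Measure.isProbabilityMeasure_map aemeasurable_id⟩ :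
        ProbabilityMeasure E) = G := Subtype.ext Measure.map_id
    rw [hid]
    exact hlim.congr' (hpos.mono fun j hj =>
      Subtype.ext ((h j).hasLaw_meanDiff hj.1 hj.2 _).map_eq.symm)

theorem exists_isGaussian_tendstoInDistribution_TCFF (hE : IsTypeTwo E)
    (hm : Tendsto m l atTop) (hn : Tendsto n l atTop)
    (h : ∀ j, IsShiftedTwoSample (P j) μ (shrinkingShift δ (m j) (n j)) (X j) (Y j))
    (hμ : MemLp id 2 μ) :
    ∃ (G : Measure E) (_ : IsGaussian G),
      ∫ x, x ∂G = δ ∧ covarianceBilinDual G = covarianceBilinDual μ ∧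
      TendstoInDistribution (fun j ω => (n j : ℝ) / (m j + n j) *
          TCFF (fun i => X j i ω) (fun i => Y j i ω))
        l (fun x : E => ‖x‖ ^ 2) P G := by
  obtain ⟨G, hG, hmean, hcov, hlim⟩ :=
    exists_isGaussian_tendstoInDistribution_meanDiff hE hm hn h hμ
  refine ⟨G, hG, hmean, hcov, (hlim.continuous_comp (g := fun x : E => ‖x‖ ^ 2)
    (by fun_prop)).congr (fun j => ae_of_all _ fun ω => ?_) (ae_of_all _ fun x => rfl)⟩
  simp only [Function.comp_apply, meanDiff, TCFF]
  rw [norm_smul, mul_pow, Real.norm_eq_abs, sq_abs, Real.sq_sqrt (by positivity), norm_sub_rev]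
  ring

end MeanDifference

section Spectral

variable {H : Type*} [NormedAddCommGroup H] [InnerProductSpace ℝ H] {A : H →L[ℝ] H}

theorem inner_map_self_le_of_forall_eigenvalue_le [CompleteSpace H] (hA : IsCompactOperator A)
    (hs : A.IsSymmetric) {M : ℝ} (hM : ∀ (c : ℝ) (x : H), x ≠ 0 → A x = c • x → c ≤ M) (x : H) :
    ⟪A x, x⟫_ℝ ≤ M * ‖x‖ ^ 2 := by
  have hdense : (⨆ c, Module.End.eigenspace (A : Module.End ℝ H) c).topologicalClosure = ⊤ :=
    (Submodule.topologicalClosure_eq_top_iff).2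
      (ContinuousLinearMap.orthogonalComplement_iSup_eigenspaces_eq_bot hA hs)
  have hclosed : IsClosed {x : H | ⟪A x, x⟫_ℝ ≤ M * ‖x‖ ^ 2} :=
    isClosed_le (by fun_prop) (by fun_prop)
  refine closure_minimal (fun y hy => ?_) hclosed (hdense ▸ Submodule.mem_top : x ∈ _)
  obtain ⟨f, hf, rfl⟩ := (Submodule.mem_iSup_iff_exists_finsupp _ _).1 hy
  have heig (c : ℝ) : A (f c) = c • f c := by simpa using Module.End.mem_eigenspace_iff.1 (hf c)
  have hinner (a : ℝ → ℝ) : ⟪∑ c ∈ f.support, a c • f c, ∑ c ∈ f.support, f c⟫_ℝ =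
      ∑ c ∈ f.support, a c * ‖f c‖ ^ 2 := by
    simpa [real_inner_smul_left] using hs.orthogonalFamily_eigenspaces.inner_sum
      (fun c => a c • ⟨f c, hf c⟩) (fun c => ⟨f c, hf c⟩) f.support
  have hnorm : ‖∑ c ∈ f.support, f c‖ ^ 2 = ∑ c ∈ f.support, ‖f c‖ ^ 2 := by
    simpa using hinner fun _ => 1
  simp only [Finsupp.sum, Set.mem_ofPred_eq, map_sum, heig]
  rw [hinner fun c => c, hnorm, Finset.mul_sum]
  exact Finset.sum_le_sum fun c hc => mul_le_mul_of_nonneg_right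
    (hM c (f c) (Finsupp.mem_support_iff.1 hc) (heig c)) (by positivity)

theorem mem_span_range_iff_sum_inner_smul_eq {ι : Type*} [Fintype ι] {u : ι → H}
    (hu : Orthonormal ℝ u) {x : H} :
    x ∈ Submodule.span ℝ (Set.range u) ↔ ∑ i, ⟪u i, x⟫_ℝ • u i = x := by
  rw [Submodule.mem_span_range_iff_exists_fun]
  refine ⟨?_, fun h => ⟨_, h⟩⟩
  rintro ⟨a, rfl⟩
  simp only [hu.inner_right_fintype]

theorem mul_norm_sq_le_inner_map_self_of_mem_span {ι : Type*} [Finite ι] {lam : ι → ℝ}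
    {u : ι → H} (hu : Orthonormal ℝ u) (heig : ∀ i, A (u i) = lam i • u i) {c : ℝ}
    (hc : ∀ i, c ≤ lam i) {x : H} (hx : x ∈ Submodule.span ℝ (Set.range u)) :
    c * ‖x‖ ^ 2 ≤ ⟪A x, x⟫_ℝ := by
  have := Fintype.ofFinite ι
  obtain ⟨a, rfl⟩ := Submodule.mem_span_range_iff_exists_fun ℝ |>.1 hx
  have hnorm : ‖∑ i, a i • u i‖ ^ 2 = ∑ i, a i ^ 2 := by
    rw [← real_inner_self_eq_norm_sq, hu.inner_sum]
    simp [pow_two]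
  have hA : A (∑ i, a i • u i) = ∑ i, (a i * lam i) • u i := by
    simp [heig, smul_smul]
  rw [hnorm, hA, hu.inner_sum, Finset.mul_sum]
  refine Finset.sum_le_sum fun i _ => ?_
  simpa [pow_two, mul_comm, mul_left_comm] using
    mul_le_mul_of_nonneg_right (hc i) (mul_self_nonneg (a i))

theorem inner_eq_zero_of_eigenvalue_ne (hs : A.IsSymmetric) {c d : ℝ} (hcd : c ≠ d) {x y : H}
    (hx : A x = c • x) (hy : A y = d • y) : ⟪x, y⟫_ℝ = 0 := by
  have h : ⟪A x, y⟫_ℝ = ⟪x, A y⟫_ℝ := hs x y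
  rw [hx, hy, real_inner_smul_left, real_inner_smul_right, ← sub_eq_zero, ← sub_mul] at h
  exact (mul_eq_zero.1 h).resolve_left (sub_ne_zero.2 hcd)

namespace IsLeadingEigensystem

variable {K : ℕ} {lam : Fin K → ℝ} {psi : Fin K → H}

theorem inner_map_self_le [CompleteSpace H] (h : IsLeadingEigensystem A lam psi)
    (hA : IsCompactOperator A) (hs : A.IsSymmetric) (k : Fin K) {x : H}
    (hx : ∀ i ≠ k, ⟪psi i, x⟫_ℝ = 0) : ⟪A x, x⟫_ℝ ≤ lam k * ‖x‖ ^ 2 := by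
  let V : Submodule ℝ H := (⨆ i : {i // i ≠ k}, ℝ ∙ psi i)ᗮ
  have hV {y : H} : y ∈ V ↔ ∀ i ≠ k, ⟪psi i, y⟫_ℝ = 0 := by
    simp only [V, ← Submodule.iInf_orthogonal, Submodule.mem_iInf,
      Submodule.mem_orthogonal_singleton_iff_inner_right, Subtype.forall]
  have hinv : ∀ y ∈ V, A y ∈ V := fun y hy => hV.2 fun i hi => by
    have hsym : ⟪A (psi i), y⟫_ℝ = ⟪psi i, A y⟫_ℝ := hs _ _
    rw [← hsym, h.eigen, real_inner_smul_left, hV.1 hy i hi, mul_zero]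
  have : CompleteSpace V := (Submodule.isClosed_orthogonal _).completeSpace_coe
  refine inner_map_self_le_of_forall_eigenvalue_le (A := A.restrict hinv) (M := lam k)
    (hA.restrict' hinv) (hs.restrict_invariant hinv) (fun c y hy hcy => ?_) ⟨x, hV.2 hx⟩
  have hAy : A y = c • (y : H) := congrArg Subtype.val hcy
  by_contra! hlt
  refine hlt.not_ge (h.largest c y (by simpa using hy) hAy (fun i => ?_) k)
  rcases eq_or_ne i k with rfl | hi
  · exact inner_eq_zero_of_eigenvalue_ne hs hlt.ne (h.eigen i) hAy
  · exact hV.1 y.2 i hi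

theorem le_eigenvalue [CompleteSpace H] (h : IsLeadingEigensystem A lam psi)
    (hA : IsCompactOperator A) (hs : A.IsSymmetric) {V : Submodule ℝ H} [FiniteDimensional ℝ V]
    (hV : K ≤ Module.finrank ℝ V) {c : ℝ} (hc : ∀ x ∈ V, c * ‖x‖ ^ 2 ≤ ⟪A x, x⟫_ℝ) (k : Fin K) :
    c ≤ lam k := by
  let F : V →ₗ[ℝ] ({i // i ≠ k} → ℝ) :=
    LinearMap.pi fun i => (innerₗ H (psi i)).comp V.subtype
  have hF : LinearMap.ker F ≠ ⊥ := LinearMap.ker_ne_bot_of_finrank_lt <| by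
    have := k.pos
    simp only [Module.finrank_fintype_fun_eq_card, ne_eq, Fintype.card_subtype_compl,
      Fintype.card_fin, Fintype.card_unique]
    omega
  obtain ⟨x, hx, hx0⟩ := Submodule.exists_mem_ne_zero_of_ne_bot hF
  have horth : ∀ i ≠ k, ⟪psi i, (x : H)⟫_ℝ = 0 := fun i hi => congrFun hx ⟨i, hi⟩
  have hpos : 0 < ‖(x : H)‖ ^ 2 := by
    have : (x : H) ≠ 0 := by simpa using hx0
    positivity
  exact le_of_mul_le_mul_right ((hc x x.2).trans (h.inner_map_self_le hA hs k horth)) hpos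

theorem mem_span_of_eigenvalue_gt (h : IsLeadingEigensystem A lam psi) (hs : A.IsSymmetric)
    {c : ℝ} {k : Fin K} (hc : lam k < c) {x : H} (hx : A x = c • x) :
    x ∈ Submodule.span ℝ (Set.range psi) := by
  rw [mem_span_range_iff_sum_inner_smul_eq h.orthonormal, eq_comm, ← sub_eq_zero]
  by_contra hr
  refine hc.not_ge (h.largest c _ hr ?_ (fun i => ?_) k)
  · have hcoef (i) : (⟪psi i, x⟫_ℝ * lam i) • psi i = (c * ⟪psi i, x⟫_ℝ) • psi i := by
      by_cases hi : lam i = c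
      · rw [hi, mul_comm]
      · rw [inner_eq_zero_of_eigenvalue_ne hs hi (h.eigen i) hx, zero_mul, mul_zero]
    simp only [map_sub, map_sum, map_smul, hx, h.eigen, smul_sub, Finset.smul_sum, smul_smul,
      hcoef]
  · rw [inner_sub_right, h.orthonormal.inner_right_fintype, sub_self]

theorem span_range_castSucc_eq {L : ℕ} {lam : Fin (L + 1) → ℝ}
    {psi : Fin (L + 1) → H} (h : IsLeadingEigensystem A lam psi) (hs : A.IsSymmetric)
    {mu : Fin L → ℝ} {u : Fin L → H} (hu : Orthonormal ℝ u) (heig : ∀ k, A (u k) = mu k • u k)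
    (hmu : ∀ k, lam (Fin.last L) < mu k) :
    Submodule.span ℝ (Set.range fun k : Fin L => psi k.castSucc) =
      Submodule.span ℝ (Set.range u) := by
  have hpsi : Orthonormal ℝ fun k : Fin L => psi k.castSucc :=
    h.orthonormal.comp _ (Fin.castSucc_injective L)
  have := FiniteDimensional.span_of_finite ℝ (Set.finite_range fun k : Fin L => psi k.castSucc)
  symm
  refine Submodule.eq_of_le_of_finrank_eq (Submodule.span_le.2 ?_) ?_
  · rintro _ ⟨k, rfl⟩
    have hlast : ⟪psi (Fin.last L), u k⟫_ℝ = 0 :=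
      inner_eq_zero_of_eigenvalue_ne hs (hmu k).ne (h.eigen _) (heig k)
    refine (mem_span_range_iff_sum_inner_smul_eq hpsi).2 ?_
    simpa [Fin.sum_univ_castSucc, hlast] using
      (mem_span_range_iff_sum_inner_smul_eq h.orthonormal).1
        (h.mem_span_of_eigenvalue_gt hs (hmu k) (heig k))
  · rw [finrank_span_eq_card hu.linearIndependent, finrank_span_eq_card hpsi.linearIndependent]

end IsLeadingEigensystem

/-- The spectral part `∑ₖ f(λₖ) ψₖ ⊗ ψₖ` of the operator `f(A)`, for eigenvalues `λₖ` and
orthonormal eigenvectors `ψₖ` of `A`. -/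
def leadingPart {K : ℕ} (f : ℝ → ℝ) (lam : Fin K → ℝ) (psi : Fin K → H) : H →L[ℝ] H :=
  ∑ k, f (lam k) • InnerProductSpace.rankOne ℝ (psi k) (psi k)

theorem continuous_rankOne_self : Continuous fun x : H => InnerProductSpace.rankOne ℝ x x :=
  (InnerProductSpace.rankOne ℝ).continuous.clm_apply continuous_id

theorem leadingPart_apply {K : ℕ} (f : ℝ → ℝ) (lam : Fin K → ℝ) (psi : Fin K → H) (x : H) :
    leadingPart f lam psi x = ∑ k, (f (lam k) * ⟪psi k, x⟫_ℝ) • psi k := by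
  simp [leadingPart, smul_smul]

theorem IsLeadingEigensystem.leadingPart_eq_of_eigen {L : ℕ} {lam : Fin (L + 1) → ℝ}
    {psi : Fin (L + 1) → H} (h : IsLeadingEigensystem A lam psi) (hs : A.IsSymmetric)
    {mu : Fin L → ℝ} {u : Fin L → H} (hu : Orthonormal ℝ u) (heig : ∀ k, A (u k) = mu k • u k)
    (hmu : ∀ k, lam (Fin.last L) < mu k) (f : ℝ → ℝ) :
    leadingPart f mu u =
      leadingPart f (fun k : Fin L => lam k.castSucc) (fun k : Fin L => psi k.castSucc) := by
  have hpsi : Orthonormal ℝ fun k : Fin L => psi k.castSucc :=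
    h.orthonormal.comp _ (Fin.castSucc_injective L)
  have hu_sum (k) : ∑ i : Fin L, ⟪psi i.castSucc, u k⟫_ℝ • psi i.castSucc = u k :=
    (mem_span_range_iff_sum_inner_smul_eq hpsi).1
      (h.span_range_castSucc_eq hs hu heig hmu ▸ Submodule.subset_span ⟨k, rfl⟩)
  have hpsi_sum (i : Fin L) : ∑ k, ⟪u k, psi i.castSucc⟫_ℝ • u k = psi i.castSucc :=
    (mem_span_range_iff_sum_inner_smul_eq hu).1
      (h.span_range_castSucc_eq hs hu heig hmu ▸ Submodule.subset_span ⟨i, rfl⟩)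
  have hcoef (k i : Fin L) : f (mu k) * ⟪u k, psi i.castSucc⟫_ℝ =
      f (lam i.castSucc) * ⟪u k, psi i.castSucc⟫_ℝ := by
    by_cases hki : mu k = lam i.castSucc
    · rw [hki]
    · rw [inner_eq_zero_of_eigenvalue_ne hs hki (heig k) (h.eigen _), mul_zero, mul_zero]
  ext x
  have hinner (k) : ⟪u k, x⟫_ℝ =
      ∑ i : Fin L, ⟪u k, psi i.castSucc⟫_ℝ * ⟪psi i.castSucc, x⟫_ℝ := by
    conv_lhs => rw [← hu_sum k, sum_inner]
    simp only [real_inner_smul_left, real_inner_comm (u k)]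
  simp only [leadingPart_apply, hinner, Finset.mul_sum, Finset.sum_smul, ← mul_assoc, hcoef]
  rw [Finset.sum_comm]
  refine Finset.sum_congr rfl fun i _ => ?_
  simpa only [Finset.smul_sum, smul_smul, mul_right_comm] using
    congrArg ((f (lam i.castSucc) * ⟪psi i.castSucc, x⟫_ℝ) • ·) (hpsi_sum i)

theorem exists_tendsto_of_eigen (hA : IsCompactOperator A) {α : Type*} {U : Ultrafilter α}
    {B : α → H →L[ℝ] H} (hB : Tendsto B U (𝓝 A)) {c : ℝ} (hc : 0 < c) {lam : α → ℝ} {v : α → H}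
    (hv : ∀ᶠ j in U, ‖v j‖ = 1 ∧ B j (v j) = lam j • v j ∧ c ≤ lam j) :
    ∃ mu u, c ≤ mu ∧ A u = mu • u ∧ Tendsto lam U (𝓝 mu) ∧ Tendsto v U (𝓝 u) := by
  obtain ⟨mu, hmu, hlam⟩ : ∃ mu ∈ Set.Icc c (‖A‖ + 1), Tendsto lam U (𝓝 mu) := by
    refine isCompact_Icc.ultrafilter_le_nhds' (U.map lam) (Ultrafilter.mem_map.2 ?_)
    filter_upwards [hv, hB.norm.eventually_le_const (lt_add_one ‖A‖)] with j ⟨hv1, hBv, hcj⟩ hBj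
    refine ⟨hcj, ?_⟩
    calc
      lam j ≤ ‖lam j • v j‖ := by simpa [norm_smul, hv1] using le_abs_self _
      _ ≤ ‖B j‖ := by simpa [hBv, hv1] using (B j).le_opNorm (v j)
      _ ≤ ‖A‖ + 1 := hBj
  obtain ⟨w, -, hw⟩ : ∃ w ∈ closure (A '' Metric.closedBall 0 1),
      Tendsto (fun j => A (v j)) U (𝓝 w) := by
    refine (hA.isCompact_closure_image_closedBall 1).ultrafilter_le_nhds'
      (U.map fun j => A (v j)) (Ultrafilter.mem_map.2 ?_)
    filter_upwards [hv] with j hj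
    exact subset_closure ⟨v j, by simp [hj.1], rfl⟩
  have hmu0 : mu ≠ 0 := (hc.trans_le hmu.1).ne'
  have hdiff : Tendsto (fun j => (B j - A) (v j)) U (𝓝 0) := by
    refine squeeze_zero_norm' (hv.mono fun j hj => ?_) (tendsto_iff_norm_sub_tendsto_zero.1 hB)
    simpa [hj.1] using (B j - A).le_opNorm (v j)
  have hvu : Tendsto v U (𝓝 (mu⁻¹ • w)) := by
    have := (hlam.inv₀ hmu0).smul (hw.add hdiff)
    rw [add_zero] at this
    refine this.congr' (hv.mono fun j ⟨_, hBv, hcj⟩ => ?_)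
    have : lam j ≠ 0 := (hc.trans_le hcj).ne'
    simp [hBv, smul_smul, this]
  refine ⟨mu, mu⁻¹ • w, hmu.1, ?_, hlam, hvu⟩
  rw [smul_inv_smul₀ hmu0]
  exact tendsto_nhds_unique ((A.continuous.tendsto _).comp hvu) hw

namespace IsLeadingEigensystem

variable {L : ℕ} {lam : Fin (L + 1) → ℝ} {psi : Fin (L + 1) → H}

theorem exists_eventually_le_eigenvalue [CompleteSpace H] (h : IsLeadingEigensystem A lam psi)
    (hgap : ∀ k : Fin L, lam (Fin.last L) < lam k.castSucc) {α : Type*} {l : Filter α}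
    {B : α → H →L[ℝ] H} (hB : Tendsto B l (𝓝 A)) {lam' : α → Fin L → ℝ} {psi' : α → Fin L → H}
    (h' : ∀ᶠ j in l, IsCompactOperator (B j) ∧ (B j).IsSymmetric ∧
      IsLeadingEigensystem (B j) (lam' j) (psi' j)) :
    ∃ c > lam (Fin.last L), ∀ᶠ j in l, ∀ k, c ≤ lam' j k := by
  obtain ⟨c, hc, hlast⟩ : ∃ c, (∀ k : Fin L, c ≤ lam k.castSucc) ∧ lam (Fin.last L) < c :=
    ((eventually_all.2 fun k => mem_of_superset (Ioc_mem_nhdsGT (hgap k)) fun _ h => h.2).and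
      (eventually_mem_nhdsWithin (s := Set.Ioi _))).exists
  obtain ⟨d, hd, hdc⟩ := exists_between hlast
  have hpsi : Orthonormal ℝ fun k : Fin L => psi k.castSucc :=
    h.orthonormal.comp _ (Fin.castSucc_injective L)
  have := FiniteDimensional.span_of_finite ℝ (Set.finite_range fun k : Fin L => psi k.castSucc)
  refine ⟨d, hd, ?_⟩
  filter_upwards [h', (tendsto_iff_norm_sub_tendsto_zero.1 hB).eventually_le_const
    (sub_pos.2 hdc)] with j ⟨hcomp, hsymm, hj⟩ hBA k
  refine hj.le_eigenvalue hcomp hsymm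
    (V := Submodule.span ℝ (Set.range fun k : Fin L => psi k.castSucc))
    (by simp [finrank_span_eq_card hpsi.linearIndependent]) (fun x hx => ?_) k
  have hAx : c * ‖x‖ ^ 2 ≤ ⟪A x, x⟫_ℝ :=
    mul_norm_sq_le_inner_map_self_of_mem_span hpsi (fun k => h.eigen _) hc hx
  have hdiff : |⟪(B j - A) x, x⟫_ℝ| ≤ (c - d) * ‖x‖ ^ 2 := calc
    |⟪(B j - A) x, x⟫_ℝ| ≤ ‖(B j - A) x‖ * ‖x‖ := abs_real_inner_le_norm _ _
    _ ≤ (c - d) * ‖x‖ * ‖x‖ := by gcongr; exact (B j - A).le_of_opNorm_le hBA x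
    _ = (c - d) * ‖x‖ ^ 2 := by ring
  rw [sub_apply, inner_sub_left] at hdiff
  linarith [neg_le_of_abs_le hdiff]

-- Along an ultrafilter the eigenvectors converge, because `A` is compact. The limits are
-- orthonormal eigenvectors of `A` that may differ from `psi`, but have the same leading part.
theorem tendsto_leadingPart [CompleteSpace H] (h : IsLeadingEigensystem A lam psi)
    (hA : IsCompactOperator A) (hs : A.IsSymmetric) (hlast : 0 ≤ lam (Fin.last L))
    (hgap : ∀ k : Fin L, lam (Fin.last L) < lam k.castSucc) {f : ℝ → ℝ}
    (hf : ContinuousOn f (Set.Ioi (lam (Fin.last L)))) {α : Type*} {l : Filter α}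
    {B : α → H →L[ℝ] H} (hB : Tendsto B l (𝓝 A)) {lam' : α → Fin L → ℝ} {psi' : α → Fin L → H}
    (h' : ∀ᶠ j in l, IsCompactOperator (B j) ∧ (B j).IsSymmetric ∧
      IsLeadingEigensystem (B j) (lam' j) (psi' j)) :
    Tendsto (fun j => leadingPart f (lam' j) (psi' j)) l
      (𝓝 (leadingPart f (fun k : Fin L => lam k.castSucc) fun k : Fin L => psi k.castSucc)) := by
  obtain ⟨c, hc, hle⟩ := h.exists_eventually_le_eigenvalue hgap hB h'
  refine tendsto_iff_ultrafilter _ _ _ |>.2 fun U hU => ?_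
  replace h' := h'.filter_mono hU
  replace hle := hle.filter_mono hU
  choose mu u hmu heig hlam hpsi using fun k =>
    exists_tendsto_of_eigen hA (hB.mono_left hU) (hlast.trans_lt hc) (lam := fun j => lam' j k)
      (v := fun j => psi' j k) (by
        filter_upwards [h', hle] with j ⟨_, _, hj⟩ hcj
        exact ⟨hj.orthonormal.norm_eq_one k, hj.eigen k, hcj k⟩)
  have hu : Orthonormal ℝ u := orthonormal_iff_ite.2 fun i k =>
    tendsto_nhds_unique ((hpsi i).inner (hpsi k)) <| tendsto_const_nhds.congr' <|
      h'.mono fun j hj => (orthonormal_iff_ite.1 hj.2.2.orthonormal i k).symm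
  rw [← h.leadingPart_eq_of_eigen hs hu heig fun k => hc.trans_le (hmu k)]
  refine tendsto_finsetSum _ fun k _ => Tendsto.smul ?_ ?_
  · exact (hf.continuousAt (Ioi_mem_nhds (hc.trans_le (hmu k)))).tendsto.comp (hlam k)
  · exact (continuous_rankOne_self.tendsto _).comp (hpsi k)

theorem exists_norm_leadingPart_sub_lt [CompleteSpace H] (h : IsLeadingEigensystem A lam psi)
    (hA : IsCompactOperator A) (hs : A.IsSymmetric) (hlast : 0 ≤ lam (Fin.last L))
    (hgap : ∀ k : Fin L, lam (Fin.last L) < lam k.castSucc) {f : ℝ → ℝ}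
    (hf : ContinuousOn f (Set.Ioi (lam (Fin.last L)))) {ε : ℝ} (hε : 0 < ε) :
    ∃ η > 0, ∀ (B : H →L[ℝ] H) (lam' : Fin L → ℝ) (psi' : Fin L → H), IsCompactOperator B →
      B.IsSymmetric → IsLeadingEigensystem B lam' psi' → ‖B - A‖ < η →
      ‖leadingPart f lam' psi' -
        leadingPart f (fun k : Fin L => lam k.castSucc) fun k : Fin L => psi k.castSucc‖ < ε := by
  let S : Set ((H →L[ℝ] H) × (Fin L → ℝ) × (Fin L → H)) :=
    {q | IsCompactOperator q.1 ∧ q.1.IsSymmetric ∧ IsLeadingEigensystem q.1 q.2.1 q.2.2}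
  have hlim := h.tendsto_leadingPart hA hs hlast hgap hf (l := comap Prod.fst (𝓝 A) ⊓ 𝓟 S)
    (tendsto_comap.mono_left inf_le_left) (mem_inf_of_right (mem_principal_self S))
  have hev := (tendsto_iff_norm_sub_tendsto_zero.1 hlim).eventually_lt_const hε
  rw [eventually_inf_principal, eventually_comap, Metric.eventually_nhds_iff] at hev
  obtain ⟨η, hη, hball⟩ := hev
  exact ⟨η, hη, fun B lam' psi' hB hBs hsys hBA =>
    hball (dist_eq_norm B A ▸ hBA) (B, lam', psi') rfl ⟨hB, hBs, hsys⟩⟩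

end IsLeadingEigensystem

end Spectral

section TypeTwo

variable {H : Type*} [NormedAddCommGroup H] [InnerProductSpace ℝ H] [CompleteSpace H]
  [MeasurableSpace H] [BorelSpace H]

theorem isTypeTwo_of_innerProductSpace : IsTypeTwo H := by
  refine ⟨1, one_pos, fun Ω _ P _ n U _ hind h2 h0 => le_of_eq ?_⟩
  have hU (i) : Integrable (U i) P := (h2 i).integrable (by simp)
  have hint (i j) : Integrable (fun ω => ⟪U i ω, U j ω⟫_ℝ) P := by
    refine (MemLp.integrable_mul (h2 i).norm (h2 j).norm).mono'
      ((h2 i).aestronglyMeasurable.inner (h2 j).aestronglyMeasurable)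
      (ae_of_all _ fun _ => abs_real_inner_le_norm _ _)
  simp only [← real_inner_self_eq_norm_sq, sum_inner, inner_sum]
  rw [one_mul, integral_finsetSum _ fun i _ => integrable_finsetSum _ fun j _ => hint _ _]
  refine Finset.sum_congr rfl fun i _ => ?_
  rw [integral_finsetSum _ fun j _ => hint _ _, Finset.sum_eq_single i]
  · intro j _ hji
    exact ((hind.indepFun hji).integral_bilin (hU j) (hU i) (innerSL ℝ)).trans (by simp [h0])
  · simp

end TypeTwo

section Covariance

variable {H : Type*} [NormedAddCommGroup H] [InnerProductSpace ℝ H]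

theorem isCompactOperator_rankOne (x y : H) :
    IsCompactOperator (InnerProductSpace.rankOne ℝ x y) := by
  rw [InnerProductSpace.rankOne_def']
  exact (isCompactOperator_of_locallyCompactSpace_dom (innerSL ℝ y)).clm_comp
    (ContinuousLinearMap.toSpanSingleton ℝ x)

theorem isCompactOperator_scatterOperator {n : ℕ} (x : Fin n → H) :
    IsCompactOperator (scatterOperator x) :=
  Submodule.sum_mem (compactOperator (RingHom.id ℝ) H H) fun _ _ => isCompactOperator_rankOne _ _

theorem isCompactOperator_pooledCov {m n : ℕ} (x : Fin m → H) (y : Fin n → H) :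
    IsCompactOperator (pooledCov x y) :=
  ((isCompactOperator_scatterOperator x).add (isCompactOperator_scatterOperator y)).smul _

theorem isPositive_scatterOperator {n : ℕ} (x : Fin n → H) : (scatterOperator x).IsPositive :=
  ContinuousLinearMap.isPositive_sum _ fun _ _ => InnerProductSpace.isPositive_rankOne_self _

theorem isSymmetric_pooledCov {m n : ℕ} (x : Fin m → H) (y : Fin n → H) :
    (pooledCov x y).IsSymmetric :=
  ((isPositive_scatterOperator x).isSymmetric.add
    (isPositive_scatterOperator y).isSymmetric).smul (conj_trivial _)

theorem scatterOperator_sub_const {n : ℕ} (x : Fin n → H) (a : H) :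
    scatterOperator (fun i => x i - a) = scatterOperator x := by
  refine Finset.sum_congr rfl fun i _ => ?_
  have hn : (n : ℝ) ≠ 0 := Nat.cast_ne_zero.2 (Fin.pos i).ne'
  have hmean : sampleMean (fun i => x i - a) = sampleMean x - a := by
    simp only [sampleMean, Finset.sum_sub_distrib, Finset.sum_const, Finset.card_univ,
      Fintype.card_fin, smul_sub, ← Nat.cast_smul_eq_nsmul ℝ, inv_smul_smul₀ hn]
  rw [hmean, sub_sub_sub_cancel_right]

theorem inv_smul_scatterOperator {n : ℕ} (x : Fin n → H) :
    (n : ℝ)⁻¹ • scatterOperator x = (n : ℝ)⁻¹ • ∑ i, InnerProductSpace.rankOne ℝ (x i) (x i) -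
      InnerProductSpace.rankOne ℝ (sampleMean x) (sampleMean x) := by
  rcases Nat.eq_zero_or_pos n with rfl | hn
  · simp [scatterOperator, sampleMean]
  have hn' : (n : ℝ) ≠ 0 := by positivity
  have hsum : ∑ i, x i = (n : ℝ) • sampleMean x := by rw [sampleMean, smul_inv_smul₀ hn']
  have hleft : ∑ i, InnerProductSpace.rankOne ℝ (x i) (sampleMean x) =
      (n : ℝ) • InnerProductSpace.rankOne ℝ (sampleMean x) (sampleMean x) := by
    rw [← sum_apply, ← map_sum, hsum, map_smul, smul_apply]
  have hright : ∑ i, InnerProductSpace.rankOne ℝ (sampleMean x) (x i) =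
      (n : ℝ) • InnerProductSpace.rankOne ℝ (sampleMean x) (sampleMean x) := by
    rw [← map_sum, hsum]; simp
  simp only [scatterOperator, map_sub, sub_apply, Finset.sum_sub_distrib, hleft, hright]
  simp [smul_sub, ← Nat.cast_smul_eq_nsmul ℝ, inv_smul_smul₀ hn']

variable [MeasurableSpace H] [BorelSpace H]

section SecondMoment

variable [SecondCountableTopology H]

theorem integrable_rankOne_self {μ : Measure H} (hμ : MemLp id 2 μ) :
    Integrable (fun x => InnerProductSpace.rankOne ℝ x x) μ := by
  have hsq : Integrable (fun x : H => ‖x‖ ^ 2) μ := hμ.integrable_norm_pow (by simp)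
  have : SecondCountableTopologyEither H (H →L[ℝ] H) := secondCountableTopologyEither_of_left ..
  refine hsq.mono continuous_rankOne_self.stronglyMeasurable.aestronglyMeasurable
    (ae_of_all _ fun x => ?_)
  rw [InnerProductSpace.norm_rankOne, Real.norm_of_nonneg (by positivity), pow_two]

theorem covOperator_eq_integral_sub [CompleteSpace H] {μ : Measure H} [IsProbabilityMeasure μ]
    (hμ : MemLp id 2 μ) :
    covOperator μ = ∫ x, InnerProductSpace.rankOne ℝ x x ∂μ -
      InnerProductSpace.rankOne ℝ (∫ x, x ∂μ) (∫ x, x ∂μ) := by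
  have hint := integrable_rankOne_self hμ
  have hid : Integrable (fun x : H => x) μ := hμ.integrable (by simp)
  refine ContinuousLinearMap.ext fun u => ext_inner_right ℝ fun v => ?_
  rw [covOperator, InnerProductSpace.continuousLinearMapOfBilin_apply,
    covarianceBilin_apply_eq_cov hμ, covariance_eq_sub (X := fun x => ⟪u, x⟫_ℝ)
      (Y := fun x => ⟪v, x⟫_ℝ) (hμ.const_inner u) (hμ.const_inner v), sub_apply,
    inner_sub_left, ContinuousLinearMap.integral_apply hint, real_inner_comm v,
    ← integral_inner (hint.apply_continuousLinearMap u)]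
  simp only [Pi.mul_apply, InnerProductSpace.rankOne_apply, inner_smul_right,
    integral_inner hid, real_inner_comm v, real_inner_comm u]

theorem isCompactOperator_covOperator [CompleteSpace H] {μ : Measure H} [IsProbabilityMeasure μ]
    (hμ : MemLp id 2 μ) : IsCompactOperator (covOperator μ) := by
  have hconvex : Convex ℝ {A : H →L[ℝ] H | IsCompactOperator A} :=
    Submodule.convex (compactOperator (RingHom.id ℝ) H H)
  have hmoment : IsCompactOperator (∫ x, InnerProductSpace.rankOne ℝ x x ∂μ : H →L[ℝ] H) :=
    hconvex.integral_mem isClosed_setOfPred_isCompactOperator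
      (ae_of_all _ fun x => isCompactOperator_rankOne x x)
      (integrable_rankOne_self hμ)
  rw [covOperator_eq_integral_sub hμ]
  exact hmoment.sub (isCompactOperator_rankOne _ _)

end SecondMoment

theorem isPositive_covOperator [CompleteSpace H] (μ : Measure H) :
    (covOperator μ).IsPositive := by
  refine (ContinuousLinearMap.isPositive_iff _).2 ⟨fun x y => ?_, fun x => ?_⟩
  · simp only [ContinuousLinearMap.coe_coe, covOperator]
    rw [InnerProductSpace.continuousLinearMapOfBilin_apply, real_inner_comm,
      InnerProductSpace.continuousLinearMapOfBilin_apply, covarianceBilin_comm]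
  · rw [covOperator, InnerProductSpace.continuousLinearMapOfBilin_apply]
    exact covarianceBilin_self_nonneg x

end Covariance

section Consistency

variable {H : Type*} [NormedAddCommGroup H] [InnerProductSpace ℝ H]

theorem tendsto_pooledCov {α : Type*} {l : Filter α} {m n : α → ℕ}
    (hm : Tendsto m l atTop) (hn : Tendsto n l atTop) {x : ∀ j, Fin (m j) → H}
    {y : ∀ j, Fin (n j) → H} {S : H →L[ℝ] H}
    (hx : Tendsto (fun j => (m j : ℝ)⁻¹ • scatterOperator (x j)) l (𝓝 S))
    (hy : Tendsto (fun j => (n j : ℝ)⁻¹ • scatterOperator (y j)) l (𝓝 S)) :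
    Tendsto (fun j => pooledCov (x j) (y j)) l (𝓝 S) := by
  have hN : Tendsto (fun j => (m j : ℝ) + n j - 2) l atTop :=
    tendsto_atTop_add_const_right l _ (Tendsto.atTop_add_nonneg
      (tendsto_natCast_atTop_atTop.comp hm) fun j => Nat.cast_nonneg (n j))
  have hbound {k k' : α → ℕ} (hk' : Tendsto k' l atTop) :
      l.IsBoundedUnder (· ≤ ·) fun j => ‖((k j : ℝ) + k' j - 2)⁻¹ * k j‖ := by
    refine ⟨1, eventually_map.2 ((hk'.eventually_ge_atTop 3).mono fun j hj => ?_)⟩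
    have hj' : (3 : ℝ) ≤ k' j := by exact_mod_cast hj
    have hpos : 0 < (k j : ℝ) + k' j - 2 := by linarith [Nat.cast_nonneg (α := ℝ) (k j)]
    change ‖_‖ ≤ 1
    rw [Real.norm_of_nonneg (by positivity), inv_mul_le_one₀ hpos]
    linarith
  have hlim := (((hbound (k := m) hn).smul_tendsto_zero (tendsto_sub_nhds_zero_iff.2 hx)).add
    ((hbound (k := n) hm).smul_tendsto_zero (tendsto_sub_nhds_zero_iff.2 hy))).add
      (hN.inv_tendsto_atTop.smul_const ((2 : ℝ) • S))
  rw [add_zero, zero_smul, add_zero] at hlim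
  refine tendsto_sub_nhds_zero_iff.1 (hlim.congr' ?_)
  filter_upwards [hm.eventually_gt_atTop 0, hn.eventually_gt_atTop 0, hN.eventually_gt_atTop 0]
    with j hmj hnj hNj
  have hm0 : (m j : ℝ) ≠ 0 := by positivity
  have hn0 : (n j : ℝ) ≠ 0 := by positivity
  have hN' : (n j : ℝ) + m j - 2 = m j + n j - 2 := by ring
  have hN0 := hNj.ne'
  simp only [pooledCov, Pi.inv_apply, hN']
  generalize hNdef : (m j : ℝ) + n j - 2 = N at hN0 ⊢
  match_scalars <;> field_simp
  linarith

theorem continuous_pooledCov {m n : ℕ} :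
    Continuous fun z : Fin m ⊕ Fin n → H =>
      pooledCov (fun i => z (.inl i)) (fun i => z (.inr i)) := by
  have hscatter {k : ℕ} : Continuous (scatterOperator : (Fin k → H) → H →L[ℝ] H) :=
    continuous_finsetSum _ fun i _ => continuous_rankOne_self.comp
      (by simp only [sampleMean]; fun_prop)
  exact ((hscatter.comp (by fun_prop)).add (hscatter.comp (by fun_prop))).const_smul
    ((m : ℝ) + n - 2)⁻¹

theorem ae_tendsto_average_comp {E B Ω : Type*} [MeasurableSpace E] [NormedAddCommGroup B]
    [NormedSpace ℝ B] [CompleteSpace B] [MeasurableSpace Ω] {μ : Measure E} {Q : Measure Ω}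
    {U : ℕ → Ω → E} (hU : ∀ i, HasLaw (U i) μ Q)
    (hind : Pairwise fun i j => IndepFun (U i) (U j) Q) {f : E → B} (hf : StronglyMeasurable f)
    (hint : Integrable f μ) :
    ∀ᵐ ω ∂Q, Tendsto (fun n : ℕ => (n : ℝ)⁻¹ • ∑ i : Fin n, f (U i ω)) atTop
      (𝓝 (∫ x, f x ∂μ)) := by
  borelize B
  have hlaw (i) : HasLaw (fun ω => f (U i ω)) (μ.map f) Q :=
    HasLaw.fun_comp ⟨hf.measurable.aemeasurable, rfl⟩ (hU i)
  have hint0 : Integrable (fun ω => f (U 0 ω)) Q :=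
    (integrable_map_measure hf.aestronglyMeasurable (hU 0).aemeasurable).1
      (by rwa [(hU 0).map_eq])
  have hmean : ∫ ω, f (U 0 ω) ∂Q = ∫ x, f x ∂μ := (hU 0).integral_comp hf.aestronglyMeasurable
  filter_upwards [strong_law_ae (fun i ω => f (U i ω)) hint0
    (fun i j hij => (hind hij).comp hf.measurable hf.measurable)
    fun i => (hlaw i).identDistrib (hlaw 0)] with ω hω
  simpa only [Finset.sum_range, hmean] using hω

variable [SecondCountableTopology H] [MeasurableSpace H] [BorelSpace H] [CompleteSpace H]
  {μ : Measure H} [IsProbabilityMeasure μ]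

theorem ae_tendsto_inv_smul_scatterOperator {Ω : Type*} [MeasurableSpace Ω] {Q : Measure Ω}
    {U : ℕ → Ω → H} (hU : ∀ i, HasLaw (U i) μ Q)
    (hind : Pairwise fun i j => IndepFun (U i) (U j) Q) (hμ : MemLp id 2 μ) :
    ∀ᵐ ω ∂Q, Tendsto (fun n : ℕ => (n : ℝ)⁻¹ • scatterOperator fun i : Fin n => U i ω) atTop
      (𝓝 (covOperator μ)) := by
  have : SecondCountableTopologyEither H (H →L[ℝ] H) := secondCountableTopologyEither_of_left ..
  filter_upwards [ae_tendsto_average_comp hU hind continuous_rankOne_self.stronglyMeasurable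
      (integrable_rankOne_self hμ),
    ae_tendsto_average_comp hU hind stronglyMeasurable_id (hμ.integrable (by simp))]
    with ω hsq hmean
  rw [covOperator_eq_integral_sub hμ]
  simp only [inv_smul_scatterOperator]
  exact hsq.sub ((continuous_rankOne_self.tendsto _).comp hmean)

theorem tendstoInMeasure_pooledCov_infinitePi {α : Type*} {l : Filter α} [l.IsCountablyGenerated]
    {m n : α → ℕ} (hm : Tendsto m l atTop) (hn : Tendsto n l atTop) (hμ : MemLp id 2 μ) :
    TendstoInMeasure (Measure.infinitePi fun _ : ℕ ⊕ ℕ => μ)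
      (fun j z => pooledCov (fun i : Fin (m j) => z (.inl i)) (fun i : Fin (n j) => z (.inr i))) l
      fun _ => covOperator μ := by
  set Q := Measure.infinitePi fun _ : ℕ ⊕ ℕ => μ
  have hlaw (s) : HasLaw (fun z : ℕ ⊕ ℕ → H => z s) μ Q :=
    ⟨(measurable_pi_apply s).aemeasurable,
      (measurePreserving_eval_infinitePi (fun _ => μ) s).map_eq⟩
  have hind : iIndepFun (fun s (z : ℕ ⊕ ℕ → H) => z s) Q :=
    iIndepFun_infinitePi (X := fun _ => id) fun _ => measurable_id
  have hscatter (e : ℕ → ℕ ⊕ ℕ) (he : e.Injective) := ae_tendsto_inv_smul_scatterOperator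
    (fun i => hlaw (e i)) (fun i j hij => hind.indepFun (he.ne hij)) hμ
  intro ε hε
  refine tendsto_of_seq_tendsto fun u hu => ?_
  refine tendstoInMeasure_of_tendsto_ae (fun k => ?_) ?_ ε hε
  · have : Measurable fun (z : ℕ ⊕ ℕ → H) (s : Fin (m (u k)) ⊕ Fin (n (u k))) =>
        z (Sum.map Fin.val Fin.val s) := by fun_prop
    exact (continuous_pooledCov.stronglyMeasurable.comp_measurable this).aestronglyMeasurable
  · filter_upwards [hscatter _ Sum.inl_injective, hscatter _ Sum.inr_injective] with z hx hy
    exact tendsto_pooledCov (hm.comp hu) (hn.comp hu) (hx.comp (hm.comp hu))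
      (hy.comp (hn.comp hu))

theorem tendsto_measure_norm_pooledCov_sub_covOperator_ge {α : Type*} {l : Filter α}
    [l.IsCountablyGenerated] {m n : α → ℕ} (hm : Tendsto m l atTop) (hn : Tendsto n l atTop)
    {Ω : α → Type*} [∀ j, MeasurableSpace (Ω j)] {P : ∀ j, Measure (Ω j)}
    {Δ : α → H} {X : ∀ j, Fin (m j) → Ω j → H} {Y : ∀ j, Fin (n j) → Ω j → H}
    (h : ∀ j, IsShiftedTwoSample (P j) μ (Δ j) (X j) (Y j)) (hμ : MemLp id 2 μ) {ε : ℝ}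
    (hε : 0 < ε) :
    Tendsto (fun j => P j {ω | ε ≤
      ‖pooledCov (fun i => X j i ω) (fun i => Y j i ω) - covOperator μ‖}) l (𝓝 0) := by
  refine (tendstoInMeasure_iff_norm.1 (tendstoInMeasure_pooledCov_infinitePi hm hn hμ) ε hε).congr
    fun j => ?_
  have hsample := (h j).hasLaw_centeredSample 0
  simp only [sub_zero, Measure.map_id'] at hsample
  have hrestrict : HasLaw (fun (z : ℕ ⊕ ℕ → H) (s : Fin (m j) ⊕ Fin (n j)) =>
      z (Sum.map Fin.val Fin.val s)) (Measure.pi fun _ => μ)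
      (Measure.infinitePi fun _ : ℕ ⊕ ℕ => μ) :=
    ⟨(measurable_pi_lambda _ fun _ => measurable_pi_apply _).aemeasurable, by
      rw [Measure.map_infinitePi_infinitePi_of_inj (P := fun _ : ℕ ⊕ ℕ => μ)
        (Fin.val_injective.sumMap Fin.val_injective), Measure.infinitePi_eq_pi]⟩
  have hset : MeasurableSet {z : Fin (m j) ⊕ Fin (n j) → H |
      ε ≤ ‖pooledCov (fun i => z (.inl i)) (fun i => z (.inr i)) - covOperator μ‖} :=
    measurableSet_le measurable_const (continuous_pooledCov.sub continuous_const).norm.measurable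
  have hshift (ω) : pooledCov (fun i => X j i ω) (fun i => Y j i ω) =
      pooledCov (fun i => X j i ω - 0) (fun i => Y j i ω - Δ j - 0) := by
    simp only [sub_zero, pooledCov, scatterOperator_sub_const]
  simp only [hshift]
  exact (hrestrict.measure_eq hset).trans (hsample.measure_eq hset).symm

end Consistency

section Slutsky

variable {α : Type*} {l : Filter α} {Ω : α → Type*} [∀ j, MeasurableSpace (Ω j)]
  {P : ∀ j, Measure (Ω j)} [∀ j, IsProbabilityMeasure (P j)]
  {Ω' : Type*} [MeasurableSpace Ω'] {P' : Measure Ω'} [IsProbabilityMeasure P']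

theorem tendstoInDistribution_of_map_eq {F : Type*} [TopologicalSpace F] [MeasurableSpace F]
    [OpensMeasurableSpace F] {S : α → Type*} [∀ j, MeasurableSpace (S j)]
    {Q : ∀ j, Measure (S j)} [∀ j, IsProbabilityMeasure (Q j)]
    {S' : Type*} [MeasurableSpace S'] {Q' : Measure S'} [IsProbabilityMeasure Q']
    {X : ∀ j, Ω j → F} {Z : Ω' → F} {Y : ∀ j, S j → F} {W : S' → F}
    (hXZ : TendstoInDistribution X l Z P P') (hY : ∀ j, AEMeasurable (Y j) (Q j))
    (hW : AEMeasurable W Q') (hYX : ∀ j, (Q j).map (Y j) = (P j).map (X j))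
    (hWZ : Q'.map W = P'.map Z) : TendstoInDistribution Y l W Q Q' where
  forall_aemeasurable := hY
  aemeasurable_limit := hW
  tendsto := by simpa only [hYX, hWZ] using hXZ.tendsto

theorem hasLaw_comp_eval_infinitePi {B : Type*} [MeasurableSpace B] {j : α} {f : Ω j → B}
    (hf : AEMeasurable f (P j)) :
    HasLaw (fun x : ∀ j, Ω j => f (x j)) ((P j).map f) (Measure.infinitePi P) :=
  HasLaw.comp ⟨hf, rfl⟩ (measurePreserving_eval_infinitePi P j).hasLaw

-- The coordinates of `∏ⱼ Ωⱼ` realize all the variables on one probability space, as the version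
-- of Slutsky's theorem in Mathlib requires.
theorem tendstoInDistribution_comp_prodMk_of_tendsto_measure_norm_sub_ge
    [l.IsCountablyGenerated] {E E' F : Type*} [SeminormedAddCommGroup E]
    [SecondCountableTopology E] [MeasurableSpace E] [BorelSpace E] [SeminormedAddCommGroup E']
    [SecondCountableTopology E'] [MeasurableSpace E'] [BorelSpace E'] [TopologicalSpace F]
    [MeasurableSpace F] [BorelSpace F] {g : E × E' → F} (hg : Continuous g)
    {X : ∀ j, Ω j → E} {Y : ∀ j, Ω j → E'} {Z : Ω' → E} {c : E'}
    (hXZ : TendstoInDistribution X l Z P P') (hY : ∀ j, AEMeasurable (Y j) (P j))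
    (hYc : ∀ ε : ℝ, 0 < ε → Tendsto (fun j => P j {ω | ε ≤ ‖Y j ω - c‖}) l (𝓝 0)) :
    TendstoInDistribution (fun j ω => g (X j ω, Y j ω)) l (fun ω => g (Z ω, c)) P P' := by
  have hX := hXZ.forall_aemeasurable
  have hXQ (j) := hasLaw_comp_eval_infinitePi (hX j)
  have hYQ (j) := hasLaw_comp_eval_infinitePi (hY j)
  have hlim := (tendstoInDistribution_of_map_eq hXZ (fun j => (hXQ j).aemeasurable)
    hXZ.aemeasurable_limit (fun j => (hXQ j).map_eq) rfl)
      |>.continuous_comp_prodMk_of_tendstoInMeasure_const hg (c := c)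
      (tendstoInMeasure_iff_norm.2 fun ε hε => (hYc ε hε).congr fun j => ?_)
      fun j => (hYQ j).aemeasurable
  · have hgXY (j) : AEMeasurable (fun ω => g (X j ω, Y j ω)) (P j) :=
      hg.measurable.comp_aemeasurable ((hX j).prodMk (hY j))
    exact tendstoInDistribution_of_map_eq hlim hgXY hlim.aemeasurable_limit
      (fun j => (hasLaw_comp_eval_infinitePi (hgXY j)).map_eq.symm) rfl
  · have hset : MeasurableSet {y : E' | ε ≤ ‖y - c‖} :=
      (isClosed_le continuous_const (by fun_prop)).measurableSet
    exact ((⟨hY j, rfl⟩ : HasLaw (Y j) _ (P j)).measure_eq hset).trans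
      ((hYQ j).measure_eq hset).symm

theorem tendstoInDistribution_inner_map_self [l.IsCountablyGenerated] {H : Type*}
    [NormedAddCommGroup H] [InnerProductSpace ℝ H] [SecondCountableTopology H]
    [MeasurableSpace H] [BorelSpace H] {D : ∀ j, Ω j → H} {Z : Ω' → H}
    {B : ∀ j, Ω j → H →L[ℝ] H} {A : H →L[ℝ] H} (hDZ : TendstoInDistribution D l Z P P')
    (hmeas : ∀ j, AEMeasurable (fun ω => ⟪D j ω, B j ω (D j ω)⟫_ℝ) (P j))
    (hBA : ∀ ε : ℝ, 0 < ε → Tendsto (fun j => P j {ω | ε ≤ ‖B j ω - A‖}) l (𝓝 0)) :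
    TendstoInDistribution (fun j ω => ⟪D j ω, B j ω (D j ω)⟫_ℝ) l
      (fun ω => ⟪Z ω, A (Z ω)⟫_ℝ) P P' := by
  have hD := hDZ.forall_aemeasurable
  let r j ω : ℝ := (⟪D j ω, B j ω (D j ω)⟫_ℝ - ⟪D j ω, A (D j ω)⟫_ℝ) / (1 + ‖D j ω‖ ^ 2)
  have hr (j) : AEMeasurable (r j) (P j) := by
    have := hD j
    have := hmeas j
    fun_prop
  have hr_le (j ω) : ‖r j ω‖ ≤ ‖B j ω - A‖ := by
    rw [norm_div, Real.norm_of_nonneg (by positivity : 0 ≤ 1 + ‖D j ω‖ ^ 2),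
      div_le_iff₀ (by positivity), ← inner_sub_right, ← _root_.sub_apply]
    calc _ ≤ ‖D j ω‖ * (‖B j ω - A‖ * ‖D j ω‖) :=
          (norm_inner_le_norm _ _).trans (by gcongr; exact (B j ω - A).le_opNorm _)
      _ ≤ ‖B j ω - A‖ * (1 + ‖D j ω‖ ^ 2) := by nlinarith [norm_nonneg (B j ω - A)]
  have hr_tendsto (ε : ℝ) (hε : 0 < ε) :
      Tendsto (fun j => P j {ω | ε ≤ ‖r j ω - 0‖}) l (𝓝 0) :=
    tendsto_of_tendsto_of_tendsto_of_le_of_le tendsto_const_nhds (hBA ε hε)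
      (fun _ => zero_le) fun j => measure_mono fun ω (hω : ε ≤ ‖r j ω - 0‖) =>
        hω.trans ((sub_zero (r j ω)).symm ▸ hr_le j ω)
  refine (tendstoInDistribution_comp_prodMk_of_tendsto_measure_norm_sub_ge
    (g := fun p : H × ℝ => ⟪p.1, A p.1⟫_ℝ + p.2 * (1 + ‖p.1‖ ^ 2)) (by fun_prop) hDZ hr
    hr_tendsto).congr (fun j => ae_of_all _ fun ω => ?_) (ae_of_all _ fun ω => by simp)
  rw [div_mul_cancel₀ _ (by positivity), add_sub_cancel]

end Slutsky

section LimitLaw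

theorem map_sq_gaussianReal {β v : ℝ} (hv : 0 < v) :
    (gaussianReal β v.toNNReal).map (fun w => w ^ 2) =
      (noncentralChiSq (β ^ 2 / v)).map (fun c => v * c) := by
  have habs : (gaussianReal β v.toNNReal).map (fun w => w ^ 2) =
      (gaussianReal |β| v.toNNReal).map (fun w => w ^ 2) := by
    rcases abs_choice β with h | h
    · rw [h]
    · rw [h, ← gaussianReal_map_neg, Measure.map_map (by fun_prop) (by fun_prop)]
      simp only [Function.comp_def, neg_sq]
  have hscale : gaussianReal |β| v.toNNReal =
      (gaussianReal (√(β ^ 2 / v)) 1).map (fun w => √v * w) := by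
    rw [gaussianReal_map_const_mul, ← Real.sqrt_mul hv.le, mul_div_cancel₀ _ hv.ne',
      Real.sqrt_sq_eq_abs]
    congr 1
    ext
    simp [Real.sq_sqrt hv.le, hv.le]
  rw [habs, hscale, noncentralChiSq, Measure.map_map (by fun_prop) (by fun_prop),
    Measure.map_map (by fun_prop) (by fun_prop)]
  simp only [Function.comp_def, mul_pow, Real.sq_sqrt hv.le]

variable {H : Type*} [NormedAddCommGroup H] [InnerProductSpace ℝ H] [CompleteSpace H]
  [MeasurableSpace H] [BorelSpace H]

theorem covOperator_congr {μ ν : Measure H} (h : covarianceBilinDual μ = covarianceBilinDual ν) :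
    covOperator μ = covOperator ν := by
  simp only [covOperator, covarianceBilin, h]

theorem covarianceBilin_sum_smul_self {G : Measure H} {ι : Type*} [Fintype ι] {psi : ι → H}
    (hpsi : Orthonormal ℝ psi) {lam : ι → ℝ}
    (heig : ∀ k, covOperator G (psi k) = lam k • psi k) (t : ι → ℝ) :
    covarianceBilin G (∑ k, t k • psi k) (∑ k, t k • psi k) = ∑ k, lam k * t k ^ 2 := by
  rw [← InnerProductSpace.continuousLinearMapOfBilin_apply]
  change ⟪covOperator G _, _⟫_ℝ = _
  simp only [map_sum, map_smul, heig, smul_smul, sum_inner, inner_smul_left,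
    hpsi.inner_right_fintype, conj_trivial]
  exact Finset.sum_congr rfl fun k _ => by ring

variable [SecondCountableTopology H]

theorem map_inner_eq_pi_gaussianReal {G : Measure H} [IsGaussian G] {ι : Type*} [Fintype ι]
    {psi : ι → H} (hpsi : Orthonormal ℝ psi) {lam : ι → ℝ} (hlam : ∀ k, 0 ≤ lam k)
    (heig : ∀ k, covOperator G (psi k) = lam k • psi k) :
    G.map (fun x k => ⟪x, psi k⟫_ℝ) =
      Measure.pi fun k => gaussianReal ⟪∫ y, y ∂G, psi k⟫_ℝ (lam k).toNNReal := by
  rw [← charFun_eq_pi_iff]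
  intro t
  have hcharFun : charFun ((G.map fun x k => ⟪x, psi k⟫_ℝ).map (WithLp.toLp 2)) t =
      charFun G (∑ k, t k • psi k) := by
    rw [Measure.map_map (by fun_prop) (by fun_prop), charFun_apply, charFun_apply,
      integral_map (by fun_prop) (by fun_prop)]
    simp only [Function.comp_apply, PiLp.inner_apply, inner_sum, inner_smul_right,
      RCLike.inner_apply, conj_trivial]
  rw [hcharFun, IsGaussian.charFun_eq', covarianceBilin_sum_smul_self hpsi heig]
  simp only [charFun_gaussianReal, ← Complex.exp_sum, Finset.sum_sub_distrib, sum_inner,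
    inner_smul_left, conj_trivial, real_inner_comm (psi _), id]
  push_cast [Real.coe_toNNReal _ (hlam _)]
  rw [Finset.sum_mul, Finset.sum_div]

theorem map_inner_sq_eq_map_pi_noncentralChiSq {G : Measure H} [IsGaussian G] {ι : Type*}
    [Fintype ι] {psi : ι → H} (hpsi : Orthonormal ℝ psi) {lam : ι → ℝ} (hlam : ∀ k, 0 < lam k)
    (heig : ∀ k, covOperator G (psi k) = lam k • psi k) :
    G.map (fun x k => ⟪x, psi k⟫_ℝ ^ 2) =
      (Measure.pi fun k => noncentralChiSq (⟪∫ y, y ∂G, psi k⟫_ℝ ^ 2 / lam k)).map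
        (fun c k => lam k * c k) := by
  have (k : ι) : IsProbabilityMeasure
      ((noncentralChiSq (⟪∫ y, y ∂G, psi k⟫_ℝ ^ 2 / lam k)).map fun c => lam k * c) :=
    Measure.isProbabilityMeasure_map (by fun_prop)
  have (k : ι) : IsProbabilityMeasure
      ((gaussianReal ⟪∫ y, y ∂G, psi k⟫_ℝ (lam k).toNNReal).map fun w => w ^ 2) :=
    Measure.isProbabilityMeasure_map (by fun_prop)
  calc G.map (fun x k => ⟪x, psi k⟫_ℝ ^ 2)
      = (G.map fun x k => ⟪x, psi k⟫_ℝ).map fun (y : ι → ℝ) (k : ι) => y k ^ 2 := by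
        rw [Measure.map_map (by fun_prop) (by fun_prop)]
        rfl
    _ = Measure.pi fun k =>
          (gaussianReal ⟪∫ y, y ∂G, psi k⟫_ℝ (lam k).toNNReal).map fun w => w ^ 2 := by
        rw [map_inner_eq_pi_gaussianReal hpsi (fun k => (hlam k).le) heig,
          Measure.pi_map_pi (f := fun _ w => w ^ 2) fun k => by fun_prop]
    _ = _ := by
        rw [Measure.pi_map_pi (f := fun k c => lam k * c) fun k => by fun_prop]
        simp only [map_sq_gaussianReal (hlam _)]

end LimitLaw

section Projection

variable {H : Type*} [NormedAddCommGroup H] [InnerProductSpace ℝ H]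

theorem inner_leadingPart_self {K : ℕ} (f : ℝ → ℝ) (lam : Fin K → ℝ) (psi : Fin K → H) (x : H) :
    ⟪x, leadingPart f lam psi x⟫_ℝ = ∑ k, f (lam k) * ⟪x, psi k⟫_ℝ ^ 2 := by
  rw [leadingPart_apply, inner_sum]
  exact Finset.sum_congr rfl fun k _ => by rw [inner_smul_right, real_inner_comm]; ring

theorem inner_meanDiff_sq {m n : ℕ} (x : Fin m → H) (y : Fin n → H) (u : H) :
    ⟪meanDiff x y, u⟫_ℝ ^ 2 =
      (m : ℝ) * n / (m + n) * ⟪sampleMean x - sampleMean y, u⟫_ℝ ^ 2 := by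
  rw [meanDiff, inner_smul_left, conj_trivial, mul_pow, Real.sq_sqrt (by positivity),
    ← neg_sub (sampleMean x), inner_neg_left, neg_sq]

theorem inner_leadingPart_one_meanDiff {m n L : ℕ} (lam : Fin L → ℝ) (psi : Fin L → H)
    (x : Fin m → H) (y : Fin n → H) :
    ⟪meanDiff x y, leadingPart (fun _ => 1) lam psi (meanDiff x y)⟫_ℝ =
      (m : ℝ) * n / (m + n) * THKR1 psi x y := by
  simp only [inner_leadingPart_self, inner_meanDiff_sq, THKR1, Finset.mul_sum, one_mul]

theorem inner_leadingPart_inv_meanDiff {m n L : ℕ} (lam : Fin L → ℝ) (psi : Fin L → H)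
    (x : Fin m → H) (y : Fin n → H) :
    ⟪meanDiff x y, leadingPart Inv.inv lam psi (meanDiff x y)⟫_ℝ =
      (m : ℝ) * n / (m + n) * THKR2 lam psi x y := by
  simp only [inner_leadingPart_self, inner_meanDiff_sq, THKR2, Finset.mul_sum,
    mul_left_comm (_⁻¹)]

variable [MeasurableSpace H] [BorelSpace H]

theorem map_inner_leadingPart_eq_map_pi_noncentralChiSq [CompleteSpace H]
    [SecondCountableTopology H] {G : Measure H} [IsGaussian G]
    {K : ℕ} {psi : Fin K → H} (hpsi : Orthonormal ℝ psi) {lam : Fin K → ℝ}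
    (hlam : ∀ k, 0 < lam k) (heig : ∀ k, covOperator G (psi k) = lam k • psi k) (f : ℝ → ℝ) :
    G.map (fun x => ⟪x, leadingPart f lam psi x⟫_ℝ) =
      (Measure.pi fun k => noncentralChiSq (⟪∫ y, y ∂G, psi k⟫_ℝ ^ 2 / lam k)).map
        (fun c => ∑ k, f (lam k) * (lam k * c k)) := by
  have hsum := congrArg (Measure.map fun s : Fin K → ℝ => ∑ k, f (lam k) * s k)
    (map_inner_sq_eq_map_pi_noncentralChiSq hpsi hlam heig)
  rw [Measure.map_map (by fun_prop) (by fun_prop),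
    Measure.map_map (by fun_prop) (by fun_prop)] at hsum
  simpa only [inner_leadingPart_self, Function.comp_def] using hsum

theorem aemeasurable_eigenvalue_pooledCov [SecondCountableTopology H] {Ω : Type*}
    [MeasurableSpace Ω] {P : Measure Ω}
    {m n L : ℕ} {X : Fin m → Ω → H} {Y : Fin n → Ω → H} (hX : ∀ i, AEMeasurable (X i) P)
    (hY : ∀ i, AEMeasurable (Y i) P) {lam : Fin L → Ω → ℝ} {psi : Fin L → Ω → H}
    (h : ∀ᵐ ω ∂P, IsLeadingEigensystem (pooledCov (fun i => X i ω) (fun i => Y i ω))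
      (fun k => lam k ω) (fun k => psi k ω)) {k : Fin L} (hpsi : AEMeasurable (psi k) P) :
    AEMeasurable (lam k) P := by
  have hcont : Continuous fun p : (Fin m ⊕ Fin n → H) × H =>
      ⟪p.2, pooledCov (fun i => p.1 (.inl i)) (fun i => p.1 (.inr i)) p.2⟫_ℝ :=
    continuous_snd.inner ((continuous_pooledCov.comp continuous_fst).clm_apply continuous_snd)
  have hXY : AEMeasurable (fun ω s => Sum.elim X Y s ω) P :=
    aemeasurable_pi_lambda _ (Sum.forall.2 ⟨hX, hY⟩)
  refine (hcont.measurable.comp_aemeasurable (hXY.prodMk hpsi)).congr ?_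
  filter_upwards [h] with ω hω
  simp only [Function.comp_apply, Sum.elim_inl, Sum.elim_inr]
  rw [hω.eigen k, inner_smul_right, real_inner_self_eq_norm_sq, hω.orthonormal.1 k, one_pow,
    mul_one]

theorem IsLeadingEigensystem.eigenvalue_nonneg [CompleteSpace H] {μ : Measure H} {K : ℕ}
    {lam : Fin K → ℝ} {psi : Fin K → H} (h : IsLeadingEigensystem (covOperator μ) lam psi)
    (k : Fin K) : 0 ≤ lam k := by
  have hinner := (isPositive_covOperator μ).re_inner_nonneg_right (psi k)
  rw [h.eigen, inner_smul_right, real_inner_self_eq_norm_sq, h.orthonormal.1] at hinner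
  simpa using hinner

section Limit

variable [CompleteSpace H] [SecondCountableTopology H] {α : Type*} {l : Filter α}
  [l.IsCountablyGenerated] {m n : α → ℕ} {Ω : α → Type*} [∀ j, MeasurableSpace (Ω j)]
  {P : ∀ j, Measure (Ω j)}
  {μ : Measure H} [IsProbabilityMeasure μ] {L : ℕ} {lam : Fin (L + 1) → ℝ}
  {psi : Fin (L + 1) → H} {lamHat : ∀ j, Fin L → Ω j → ℝ} {psiHat : ∀ j, Fin L → Ω j → H}
  {X : ∀ j, Fin (m j) → Ω j → H} {Y : ∀ j, Fin (n j) → Ω j → H} {f : ℝ → ℝ}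

theorem tendsto_measure_norm_leadingPart_sub_ge (hm : Tendsto m l atTop) (hn : Tendsto n l atTop)
    {Δ : α → H} (h : ∀ j, IsShiftedTwoSample (P j) μ (Δ j) (X j) (Y j)) (hμ : MemLp id 2 μ)
    (hsys : IsLeadingEigensystem (covOperator μ) lam psi)
    (hgap : ∀ k : Fin L, lam (Fin.last L) < lam k.castSucc)
    (hhat : ∀ j, ∀ᵐ ω ∂(P j), IsLeadingEigensystem
      (pooledCov (fun i => X j i ω) (fun i => Y j i ω))
      (fun k => lamHat j k ω) (fun k => psiHat j k ω))
    (hf : ContinuousOn f (Set.Ioi (lam (Fin.last L)))) {ε : ℝ} (hε : 0 < ε) :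
    Tendsto (fun j => P j {ω | ε ≤ ‖leadingPart f (fun k => lamHat j k ω) (fun k => psiHat j k ω) -
      leadingPart f (fun k : Fin L => lam k.castSucc) (fun k => psi k.castSucc)‖}) l (𝓝 0) := by
  obtain ⟨η, hη, hpert⟩ := hsys.exists_norm_leadingPart_sub_lt (isCompactOperator_covOperator hμ)
    (isPositive_covOperator μ).isSymmetric (hsys.eigenvalue_nonneg _) hgap hf hε
  refine tendsto_of_tendsto_of_tendsto_of_le_of_le tendsto_const_nhds
    (tendsto_measure_norm_pooledCov_sub_covOperator_ge hm hn h hμ hη) (fun _ => zero_le)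
    fun j => measure_mono_ae ?_
  filter_upwards [hhat j] with ω hω hωε
  by_contra hlt
  exact hωε.not_gt (hpert _ _ _ (isCompactOperator_pooledCov _ _) (isSymmetric_pooledCov _ _) hω
    (not_le.1 hlt))

theorem tendstoInDistribution_inner_leadingPart_meanDiff [l.NeBot]
    [∀ j, IsProbabilityMeasure (P j)] (hm : Tendsto m l atTop) (hn : Tendsto n l atTop) {δ : H}
    (h : ∀ j, IsShiftedTwoSample (P j) μ (shrinkingShift δ (m j) (n j)) (X j) (Y j))
    (hμ : MemLp id 2 μ) (hsys : IsLeadingEigensystem (covOperator μ) lam psi)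
    (hgap : ∀ k : Fin L, lam (Fin.last L) < lam k.castSucc)
    (hpsi : ∀ j k, AEMeasurable (psiHat j k) (P j))
    (hhat : ∀ j, ∀ᵐ ω ∂(P j), IsLeadingEigensystem
      (pooledCov (fun i => X j i ω) (fun i => Y j i ω))
      (fun k => lamHat j k ω) (fun k => psiHat j k ω))
    (hf : ContinuousOn f (Set.Ioi (lam (Fin.last L)))) (hfm : Measurable f) :
    TendstoInDistribution
      (fun j ω => ⟪meanDiff (fun i => X j i ω) (fun i => Y j i ω),
        leadingPart f (fun k => lamHat j k ω) (fun k => psiHat j k ω)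
          (meanDiff (fun i => X j i ω) (fun i => Y j i ω))⟫_ℝ)
      l (fun c : Fin L → ℝ => ∑ k : Fin L, f (lam k.castSucc) * (lam k.castSucc * c k)) P
      (Measure.pi fun k : Fin L =>
        noncentralChiSq (⟪δ, psi k.castSucc⟫_ℝ ^ 2 / lam k.castSucc)) := by
  obtain ⟨G, _, hmean, hcov, hZ⟩ := exists_isGaussian_tendstoInDistribution_meanDiff
    isTypeTwo_of_innerProductSpace hm hn h hμ
  have hmeas (j) : AEMeasurable (fun ω => ⟪meanDiff (fun i => X j i ω) (fun i => Y j i ω),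
      leadingPart f (fun k => lamHat j k ω) (fun k => psiHat j k ω)
        (meanDiff (fun i => X j i ω) (fun i => Y j i ω))⟫_ℝ) (P j) := by
    have hD := hZ.forall_aemeasurable j
    have hlamHat (k) : AEMeasurable (fun ω => f (lamHat j k ω)) (P j) :=
      hfm.comp_aemeasurable (aemeasurable_eigenvalue_pooledCov
        (fun i => ((h j).law_X i).aemeasurable) (fun i => ((h j).law_Y i).aemeasurable)
        (hhat j) (hpsi j k))
    simp only [inner_leadingPart_self]
    exact Finset.aemeasurable_fun_sum _ fun k _ =>
      (hlamHat k).mul ((hD.inner (hpsi j k)).pow_const 2)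
  have hlim := tendstoInDistribution_inner_map_self hZ hmeas fun ε hε =>
    tendsto_measure_norm_leadingPart_sub_ge hm hn h hμ hsys hgap hhat hf hε
  have hlaw := map_inner_leadingPart_eq_map_pi_noncentralChiSq (G := G)
    (hsys.orthonormal.comp _ (Fin.castSucc_injective L))
    (fun k => (hsys.eigenvalue_nonneg _).trans_lt (hgap k))
    (fun k => by rw [covOperator_congr hcov]; exact hsys.eigen _) f
  have hmeas_limit : Measurable fun c : Fin L → ℝ =>
      ∑ k : Fin L, f (lam k.castSucc) * (lam k.castSucc * c k) := by fun_prop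
  rw [hmean] at hlaw
  exact tendstoInDistribution_of_map_eq hlim hmeas hmeas_limit.aemeasurable (fun _ => rfl) hlaw.symm

theorem tendstoInDistribution_THKR1_and_THKR2 [l.NeBot] [∀ j, IsProbabilityMeasure (P j)]
    (hm : Tendsto m l atTop) (hn : Tendsto n l atTop) {δ : H}
    (h : ∀ j, IsShiftedTwoSample (P j) μ (shrinkingShift δ (m j) (n j)) (X j) (Y j))
    (hμ : MemLp id 2 μ) (hsys : IsLeadingEigensystem (covOperator μ) lam psi)
    (hgap : ∀ k : Fin L, lam (Fin.last L) < lam k.castSucc)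
    (hpsi : ∀ j k, AEMeasurable (psiHat j k) (P j))
    (hhat : ∀ j, ∀ᵐ ω ∂(P j), IsLeadingEigensystem
      (pooledCov (fun i => X j i ω) (fun i => Y j i ω))
      (fun k => lamHat j k ω) (fun k => psiHat j k ω)) :
    TendstoInDistribution
        (fun j ω => (m j : ℝ) * n j / (m j + n j) *
          THKR1 (fun k => psiHat j k ω) (fun i => X j i ω) (fun i => Y j i ω))
        l (fun c : Fin L → ℝ => ∑ k : Fin L, lam k.castSucc * c k) P
        (Measure.pi fun k : Fin L =>
          noncentralChiSq (⟪δ, psi k.castSucc⟫_ℝ ^ 2 / lam k.castSucc)) ∧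
      TendstoInDistribution
        (fun j ω => (m j : ℝ) * n j / (m j + n j) *
          THKR2 (fun k => lamHat j k ω) (fun k => psiHat j k ω)
            (fun i => X j i ω) (fun i => Y j i ω))
        l (fun c : Fin L → ℝ => ∑ k : Fin L, c k) P
        (Measure.pi fun k : Fin L =>
          noncentralChiSq (⟪δ, psi k.castSucc⟫_ℝ ^ 2 / lam k.castSucc)) := by
  have hlast : 0 ≤ lam (Fin.last L) := hsys.eigenvalue_nonneg _
  have hpos (k : Fin L) : lam k.castSucc ≠ 0 := (hlast.trans_lt (hgap k)).ne'
  have hinv : ContinuousOn Inv.inv (Set.Ioi (lam (Fin.last L))) :=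
    continuousOn_inv₀.mono fun t ht => (hlast.trans_lt ht).ne'
  constructor
  · simpa only [inner_leadingPart_one_meanDiff, one_mul] using
      tendstoInDistribution_inner_leadingPart_meanDiff hm hn h hμ hsys hgap hpsi hhat
        (f := fun _ => 1) continuousOn_const measurable_const
  · simpa only [inner_leadingPart_inv_meanDiff, inv_mul_cancel_left₀ (hpos _)] using
      tendstoInDistribution_inner_leadingPart_meanDiff hm hn h hμ hsys hgap hpsi hhat hinv
        measurable_inv

end Limit

end Projection

end TwoSample

end

theorem theorem3_general
    {α : Type*} {l : Filter α} [l.NeBot] [l.IsCountablyGenerated] (m n : α → ℕ)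
    (hm : Tendsto m l atTop) (hn : Tendsto n l atTop)
    (Ω : α → Type*) [∀ j, MeasurableSpace (Ω j)]
    (P : ∀ j, Measure (Ω j)) [∀ j, IsProbabilityMeasure (P j)] :
    (∀ (E : Type*) [NormedAddCommGroup E] [NormedSpace ℝ E] [CompleteSpace E]
        [SecondCountableTopology E] [MeasurableSpace E] [BorelSpace E],
      TwoSample.IsTypeTwo E →
      ∀ (μ : Measure E) [IsProbabilityMeasure μ] (δ : E)
        (X : ∀ j, Fin (m j) → Ω j → E) (Y : ∀ j, Fin (n j) → Ω j → E),
      (∀ j, TwoSample.IsShiftedTwoSample (P j) μ (TwoSample.shrinkingShift δ (m j) (n j))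
        (X j) (Y j)) →
      MemLp id 2 μ →
      ∃ (G : Measure E) (_ : IsGaussian G),
        ∫ x, x ∂G = δ ∧ covarianceBilinDual G = covarianceBilinDual μ ∧
        TendstoInDistribution
          (fun j ω => (n j : ℝ) / (m j + n j) *
            TwoSample.TCFF (fun i => X j i ω) (fun i => Y j i ω))
          l (fun x : E => ‖x‖ ^ 2) P G) ∧
    (∀ (H : Type*) [NormedAddCommGroup H] [InnerProductSpace ℝ H] [CompleteSpace H]
        [SecondCountableTopology H] [MeasurableSpace H] [BorelSpace H]
        (μ : Measure H) [IsProbabilityMeasure μ] (δ : H)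
        (X : ∀ j, Fin (m j) → Ω j → H) (Y : ∀ j, Fin (n j) → Ω j → H),
      (∀ j, TwoSample.IsShiftedTwoSample (P j) μ (TwoSample.shrinkingShift δ (m j) (n j))
        (X j) (Y j)) →
      MemLp id 2 μ →
      ∀ (L : ℕ) (lam : Fin (L + 1) → ℝ) (psi : Fin (L + 1) → H),
      TwoSample.IsLeadingEigensystem (TwoSample.covOperator μ) lam psi →
      (∀ k : Fin L, lam (Fin.last L) < lam k.castSucc) →
      ∀ (lamHat : ∀ j, Fin L → Ω j → ℝ) (psiHat : ∀ j, Fin L → Ω j → H),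
      (∀ j k, AEMeasurable (psiHat j k) (P j)) →
      (∀ j, ∀ᵐ ω ∂(P j), TwoSample.IsLeadingEigensystem
        (TwoSample.pooledCov (fun i => X j i ω) (fun i => Y j i ω))
        (fun k => lamHat j k ω) (fun k => psiHat j k ω)) →
      TendstoInDistribution
          (fun j ω => (m j : ℝ) * n j / (m j + n j) *
            TwoSample.THKR1 (fun k => psiHat j k ω) (fun i => X j i ω) (fun i => Y j i ω))
          l (fun c : Fin L → ℝ => ∑ k : Fin L, lam k.castSucc * c k) P
          (Measure.pi (fun k : Fin L =>
            TwoSample.noncentralChiSq (⟪δ, psi k.castSucc⟫_ℝ ^ 2 / lam k.castSucc))) ∧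
      TendstoInDistribution
          (fun j ω => (m j : ℝ) * n j / (m j + n j) *
            TwoSample.THKR2 (fun k => lamHat j k ω) (fun k => psiHat j k ω)
              (fun i => X j i ω) (fun i => Y j i ω))
          l (fun c : Fin L → ℝ => ∑ k : Fin L, c k) P
          (Measure.pi (fun k : Fin L =>
            TwoSample.noncentralChiSq (⟪δ, psi k.castSucc⟫_ℝ ^ 2 / lam k.castSucc)))) :=
  ⟨fun _ _ _ _ _ _ _ hE _ _ _ _ _ h hμ =>
    TwoSample.exists_isGaussian_tendstoInDistribution_TCFF hE hm hn h hμ,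
  fun _ _ _ _ _ _ _ _ _ _ _ _ h hμ _ _ _ hsys hgap _ _ hpsi hhat =>
    TwoSample.tendstoInDistribution_THKR1_and_THKR2 hm hn h hμ hsys hgap hpsi hhat⟩

theorem theorem3
    -- the sample sizes
    (m n : ℕ → ℕ) (γ : ℝ) (hγ : γ ∈ Set.Ioo (0 : ℝ) 1)
    (hm : Tendsto m atTop atTop) (hn : Tendsto n atTop atTop)
    (hmn : Tendsto (fun j => (m j : ℝ) / (m j + n j)) atTop (𝓝 γ))
    -- the probability spaces carrying the samples
    (Ω : ℕ → Type*) [∀ j, MeasurableSpace (Ω j)]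
    (P : ∀ j, Measure (Ω j)) [∀ j, IsProbabilityMeasure (P j)] :
    -- (a)
    (∀ (E : Type*) [NormedAddCommGroup E] [NormedSpace ℝ E] [CompleteSpace E]
        [SecondCountableTopology E] [MeasurableSpace E] [BorelSpace E],
      TwoSample.IsTypeTwo E →
      ∀ (μ : Measure E) [IsProbabilityMeasure μ] (δ : E), δ ≠ 0 →
      ∀ (X : ∀ j, Fin (m j) → Ω j → E) (Y : ∀ j, Fin (n j) → Ω j → E),
      (∀ j, TwoSample.IsShiftedTwoSample (P j) μ (TwoSample.shrinkingShift δ (m j) (n j))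
        (X j) (Y j)) →
      MemLp id 2 μ →
      ∃ (G : Measure E) (_ : IsGaussian G),
        ∫ x, x ∂G = δ ∧ covarianceBilinDual G = covarianceBilinDual μ ∧
        TendstoInDistribution
          (fun j ω => (n j : ℝ) / (m j + n j) *
            TwoSample.TCFF (fun i => X j i ω) (fun i => Y j i ω))
          atTop (fun x : E => ‖x‖ ^ 2) P G) ∧
    -- (b)
    (∀ (H : Type*) [NormedAddCommGroup H] [InnerProductSpace ℝ H] [CompleteSpace H]
        [SecondCountableTopology H] [MeasurableSpace H] [BorelSpace H]
        (μ : Measure H) [IsProbabilityMeasure μ] (δ : H), δ ≠ 0 →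
      ∀ (X : ∀ j, Fin (m j) → Ω j → H) (Y : ∀ j, Fin (n j) → Ω j → H),
      (∀ j, TwoSample.IsShiftedTwoSample (P j) μ (TwoSample.shrinkingShift δ (m j) (n j))
        (X j) (Y j)) →
      MemLp id 4 μ →
      -- the `L + 1` largest eigenvalues of the covariance are distinct and positive
      ∀ (L : ℕ), 1 ≤ L →
      ∀ (lam : Fin (L + 1) → ℝ) (psi : Fin (L + 1) → H),
      TwoSample.IsLeadingEigensystem (TwoSample.covOperator μ) lam psi →
      StrictAnti lam → 0 < lam (Fin.last L) →
      -- the empirical eigenvalues and (any measurable choice of) empirical eigenvectors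
      ∀ (lamHat : ∀ j, Fin L → Ω j → ℝ) (psiHat : ∀ j, Fin L → Ω j → H),
      (∀ j k, AEMeasurable (psiHat j k) (P j)) →
      (∀ j, ∀ᵐ ω ∂(P j), TwoSample.IsLeadingEigensystem
        (TwoSample.pooledCov (fun i => X j i ω) (fun i => Y j i ω))
        (fun k => lamHat j k ω) (fun k => psiHat j k ω)) →
      TendstoInDistribution
          (fun j ω => (m j : ℝ) * n j / (m j + n j) *
            TwoSample.THKR1 (fun k => psiHat j k ω) (fun i => X j i ω) (fun i => Y j i ω))
          atTop (fun c : Fin L → ℝ => ∑ k : Fin L, lam k.castSucc * c k) P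
          (Measure.pi (fun k : Fin L =>
            TwoSample.noncentralChiSq (⟪δ, psi k.castSucc⟫_ℝ ^ 2 / lam k.castSucc))) ∧
      TendstoInDistribution
          (fun j ω => (m j : ℝ) * n j / (m j + n j) *
            TwoSample.THKR2 (fun k => lamHat j k ω) (fun k => psiHat j k ω)
              (fun i => X j i ω) (fun i => Y j i ω))
          atTop (fun c : Fin L → ℝ => ∑ k : Fin L, c k) P
          (Measure.pi (fun k : Fin L =>
            TwoSample.noncentralChiSq (⟪δ, psi k.castSucc⟫_ℝ ^ 2 / lam k.castSucc)))) := by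
  obtain ⟨ha, hb⟩ := theorem3_general m n hm hn Ω P
  exact ⟨fun E _ _ _ _ _ _ hE μ _ δ _ => ha E hE μ δ,
    fun H _ _ _ _ _ _ μ _ δ _ X Y h hμ L _ lam psi hsys hlam _ =>
      hb H μ δ X Y h (hμ.mono_exponent (by norm_num)) L lam psi hsys
        fun k => hlam (Fin.castSucc_lt_last k)⟩
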